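/- Let $p>1$ be an odd integer, $c_0:=\frac{2(p+1)}{(p-1)^2}$, and let $\mathcal H:=L^2(0,1)^2$ be the complex Hilbert space of pairs $\mathbf u=(u_1,u_2)$. Let $\tilde L_0$ be the operator in $\mathcal H$ with domain $\mathcal D(\tilde L_0):=\{\mathbf u\in C^1[0,1]^2:\ u_1(0)=0\}$ and $$\tilde L_0\mathbf u(\rho):=\big(-\rho u_1'(\rho)+u_2'(\rho),\ u_1'(\rho)-\rho u_2'(\rho)\big).$$ Define $L'\in\mathcal B(\mathcal H)$ by $L'\mathbf u(\rho):=\big(p c_0\int_0^\rho u_2(\xi)\,d\xi,\ 0\big)$. Then $\tilde L_0$ is closable; let $L_0$ be its closure and let $L:=L_0+L'$ with $\mathcal D(L)=\mathcal D(L_0)$. For an operator $A:\mathcal D(A)\subset\mathcal H\to\mathcal H$, let the resolvent set $\rho(A)$ be the set of $\lambda\in\mathbb C$ for which $\lambda-A:\mathcal D(A)\to\mathcal H$ is bijective with bounded inverse $R_A(\lambda):=(\lambda-A)^{-1}\in\mathcal B(\mathcal H)$, and let $\sigma(A):=\mathbb C\setminus\rho(A)$ be the spectrum. Then: 1. For every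 $\lambda\in\mathbb C$, one has $\lambda\in\rho(L)$ if and only if $\lambda\in\rho(L_0)$ and $I-L'R_{L_0}(\lambda)$ is invertible in $\mathcal B(\mathcal H)$. 2. $\sigma(L)=\sigma(L_0)\cup\left\{1+\frac{2}{p-1}\right\}$. 3. The only point $\lambda$ of $\sigma(L)$ with $\operatorname{Re}\lambda>\frac12$ is $\lambda=1+\frac{2}{p-1}$, and this point is an eigenvalue of $L$. -/

import Mathlib

open MeasureTheory Set

noncomputable section

namespace SimilarityWave

/-! ### Unbounded operators: resolvent set, resolvent, spectrum -/

section Operators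

variable {E : Type*} [NormedAddCommGroup E] [NormedSpace ℂ E]

/-- `R` is a bounded, everywhere defined, two-sided inverse of `z - A : D(A) → E`. -/
def IsResolventAt (A : E →ₗ.[ℂ] E) (z : ℂ) (R : E →L[ℂ] E) : Prop :=
  (∀ f : E, ∃ u : A.domain, (u : E) = R f ∧ z • (u : E) - A u = f) ∧
    ∀ u : A.domain, R (z • (u : E) - A u) = u

/-- The resolvent set `ρ(A)` of a (possibly unbounded) operator `A : D(A) ⊆ E → E`. -/
def opResolventSet (A : E →ₗ.[ℂ] E) : Set ℂ :=
  {z | ∃ R : E →L[ℂ] E, IsResolventAt A z R}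

/-- The spectrum `σ(A) = ℂ \ ρ(A)`. -/
def opSpectrum (A : E →ₗ.[ℂ] E) : Set ℂ := (opResolventSet A)ᶜ

/-- The point spectrum `σ_p(A)`: the set of all eigenvalues of `A`. -/
def opPointSpectrum (A : E →ₗ.[ℂ] E) : Set ℂ :=
  {z | ∃ u : A.domain, (u : E) ≠ 0 ∧ A u = z • (u : E)}

open Classical in
/-- The resolvent `R_A(z) = (z - A)⁻¹` for `z ∈ ρ(A)` (and `0` for `z ∉ ρ(A)`). -/
def opResolvent (A : E →ₗ.[ℂ] E) (z : ℂ) : E →L[ℂ] E :=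
  if h : ∃ R : E →L[ℂ] E, IsResolventAt A z R then h.choose else 0

theorem IsResolventAt.unique {A : E →ₗ.[ℂ] E} {z : ℂ} {R S : E →L[ℂ] E}
    (hR : IsResolventAt A z R) (hS : IsResolventAt A z S) : R = S := by
  ext f
  obtain ⟨u, hu, hf⟩ := hR.1 f
  rw [← hu, ← hS.2 u, hf]

theorem opResolvent_spec {A : E →ₗ.[ℂ] E} {z : ℂ} (hz : z ∈ opResolventSet A) :
    IsResolventAt A z (opResolvent A z) := by
  have h : ∃ R : E →L[ℂ] E, IsResolventAt A z R := hz
  rw [opResolvent, dif_pos h]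
  exact h.choose_spec

end Operators

/-! ### The Hilbert space `L²(0,1)²` -/

/-- Lebesgue measure on the interval `(0,1)`. -/
abbrev unitMeasure : Measure ℝ := volume.restrict (Ioo (0 : ℝ) 1)

/-- The complex Hilbert space `L²(0,1)`. -/
abbrev L2 : Type := Lp ℂ 2 unitMeasure

/-- The complex Hilbert space `ℋ = L²(0,1)²`. -/
abbrev H : Type := WithLp 2 (L2 × L2)

/-! ### The free operator -/

/-- The pair `v = (v₁, v₂)` lies in `C¹[0,1]²` and satisfies `v₁(0) = 0`. -/
def IsC1Pair (v₁ v₂ : ℝ → ℂ) : Prop :=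
  ContDiffOn ℝ 1 v₁ (Icc 0 1) ∧ ContDiffOn ℝ 1 v₂ (Icc 0 1) ∧ v₁ 0 = 0

/-- The derivative of a function on `[0,1]` (one-sided at the end points). -/
def D (v : ℝ → ℂ) (ρ : ℝ) : ℂ := derivWithin v (Icc 0 1) ρ

/-- The relation "`u` is represented by a pair `(v₁, v₂) ∈ C¹[0,1]²` with `v₁(0) = 0`, and
`w = (-ρ v₁' + v₂', v₁' - ρ v₂')`". -/
def FreeRel (u w : H) : Prop :=
  ∃ v₁ v₂ : ℝ → ℂ, IsC1Pair v₁ v₂ ∧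
    u.fst =ᵐ[unitMeasure] v₁ ∧ u.snd =ᵐ[unitMeasure] v₂ ∧
    w.fst =ᵐ[unitMeasure] (fun ρ => -(ρ : ℂ) * D v₁ ρ + D v₂ ρ) ∧
    w.snd =ᵐ[unitMeasure] (fun ρ => D v₁ ρ - (ρ : ℂ) * D v₂ ρ)

theorem D_add {v w : ℝ → ℂ} (hv : ContDiffOn ℝ 1 v (Icc 0 1)) (hw : ContDiffOn ℝ 1 w (Icc 0 1))
    {ρ : ℝ} (hρ : ρ ∈ Ioo (0 : ℝ) 1) : D (v + w) ρ = D v ρ + D w ρ :=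
  derivWithin_add (hv.differentiableOn one_ne_zero ρ (Ioo_subset_Icc_self hρ))
    (hw.differentiableOn one_ne_zero ρ (Ioo_subset_Icc_self hρ))

theorem D_smul (c : ℂ) {v : ℝ → ℂ} (hv : ContDiffOn ℝ 1 v (Icc 0 1))
    {ρ : ℝ} (hρ : ρ ∈ Ioo (0 : ℝ) 1) : D (c • v) ρ = c * D v ρ :=
  derivWithin_const_smul c (hv.differentiableOn one_ne_zero ρ (Ioo_subset_Icc_self hρ))

/-- The graph of `L̃₀`, as a linear subspace of `ℋ × ℋ`. -/
def freeGraph : Submodule ℂ (H × H) where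
  carrier := {x | FreeRel x.1 x.2}
  zero_mem' := by
    refine ⟨0, 0, ⟨contDiffOn_const, contDiffOn_const, rfl⟩, ?_, ?_, ?_, ?_⟩
    · exact Lp.coeFn_zero _ _ _
    · exact Lp.coeFn_zero _ _ _
    · refine (Lp.coeFn_zero ℂ 2 unitMeasure).trans (Filter.Eventually.of_forall fun ρ => ?_)
      simp [D]
    · refine (Lp.coeFn_zero ℂ 2 unitMeasure).trans (Filter.Eventually.of_forall fun ρ => ?_)
      simp [D]
  add_mem' := by
    rintro x y ⟨v₁, v₂, ⟨hv₁, hv₂, hv0⟩, h1, h2, h3, h4⟩ ⟨w₁, w₂, ⟨hw₁, hw₂, hw0⟩, k1, k2, k3, k4⟩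
    refine ⟨v₁ + w₁, v₂ + w₂, ⟨hv₁.add hw₁, hv₂.add hw₂, by simp [hv0, hw0]⟩, ?_, ?_, ?_, ?_⟩
    · exact (Lp.coeFn_add _ _).trans (h1.add k1)
    · exact (Lp.coeFn_add _ _).trans (h2.add k2)
    · refine (Lp.coeFn_add _ _).trans ((h3.add k3).trans ?_)
      filter_upwards [ae_restrict_mem measurableSet_Ioo] with ρ hρ
      simp only [Pi.add_apply, D_add hv₁ hw₁ hρ, D_add hv₂ hw₂ hρ]
      ring
    · refine (Lp.coeFn_add _ _).trans ((h4.add k4).trans ?_)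
      filter_upwards [ae_restrict_mem measurableSet_Ioo] with ρ hρ
      simp only [Pi.add_apply, D_add hv₁ hw₁ hρ, D_add hv₂ hw₂ hρ]
      ring
  smul_mem' := by
    rintro c x ⟨v₁, v₂, ⟨hv₁, hv₂, hv0⟩, h1, h2, h3, h4⟩
    refine ⟨c • v₁, c • v₂, ⟨hv₁.const_smul c, hv₂.const_smul c, by simp [hv0]⟩, ?_, ?_, ?_, ?_⟩
    · exact (Lp.coeFn_smul _ _).trans (h1.const_smul c)
    · exact (Lp.coeFn_smul _ _).trans (h2.const_smul c)
    · refine (Lp.coeFn_smul _ _).trans ((h3.const_smul c).trans ?_)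
      filter_upwards [ae_restrict_mem measurableSet_Ioo] with ρ hρ
      simp only [Pi.smul_apply, smul_eq_mul, D_smul c hv₁ hρ, D_smul c hv₂ hρ]
      ring
    · refine (Lp.coeFn_smul _ _).trans ((h4.const_smul c).trans ?_)
      filter_upwards [ae_restrict_mem measurableSet_Ioo] with ρ hρ
      simp only [Pi.smul_apply, smul_eq_mul, D_smul c hv₁ hρ, D_smul c hv₂ hρ]
      ring

theorem D_eq_zero {v : ℝ → ℂ} (hv : ContDiffOn ℝ 1 v (Icc 0 1))
    (h0 : (0 : ℝ → ℂ) =ᵐ[unitMeasure] v) {ρ : ℝ} (hρ : ρ ∈ Ioo (0 : ℝ) 1) : D v ρ = 0 := by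
  have hE : EqOn (0 : ℝ → ℂ) v (Ioo 0 1) :=
    Measure.eqOn_open_of_ae_eq h0 isOpen_Ioo continuousOn_const
      (hv.continuousOn.mono Ioo_subset_Icc_self)
  have hn : v =ᶠ[nhds ρ] fun _ => (0 : ℂ) := by
    filter_upwards [isOpen_Ioo.mem_nhds hρ] with x hx
    exact (hE hx).symm
  rw [D, derivWithin_of_mem_nhds (Icc_mem_nhds hρ.1 hρ.2), hn.deriv_eq, deriv_const]

/-- `freeGraph` is the graph of a function, so that `freeCore` below really has this graph. -/
theorem freeGraph_functional (x : H × H) (hx : x ∈ freeGraph) (h0 : x.1 = 0) : x.2 = 0 := by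
  obtain ⟨v₁, v₂, ⟨hv₁, hv₂, -⟩, h1, h2, h3, h4⟩ := hx
  rw [h0] at h1 h2
  have z1 : (0 : ℝ → ℂ) =ᵐ[unitMeasure] v₁ := (Lp.coeFn_zero ℂ 2 unitMeasure).symm.trans h1
  have z2 : (0 : ℝ → ℂ) =ᵐ[unitMeasure] v₂ := (Lp.coeFn_zero ℂ 2 unitMeasure).symm.trans h2
  have e1 : x.2.fst = 0 := by
    apply Lp.ext
    refine h3.trans (Filter.EventuallyEq.trans ?_ (Lp.coeFn_zero ℂ 2 unitMeasure).symm)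
    filter_upwards [ae_restrict_mem measurableSet_Ioo] with ρ hρ
    simp [D_eq_zero hv₁ z1 hρ, D_eq_zero hv₂ z2 hρ]
  have e2 : x.2.snd = 0 := by
    apply Lp.ext
    refine h4.trans (Filter.EventuallyEq.trans ?_ (Lp.coeFn_zero ℂ 2 unitMeasure).symm)
    filter_upwards [ae_restrict_mem measurableSet_Ioo] with ρ hρ
    simp [D_eq_zero hv₁ z1 hρ, D_eq_zero hv₂ z2 hρ]
  exact WithLp.ofLp_injective 2 (Prod.ext e1 e2)

/-- The operator `L̃₀`: its domain is `{u ∈ C¹[0,1]² : u₁(0) = 0} ⊆ ℋ`, and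
`L̃₀ u = (-ρ u₁' + u₂', u₁' - ρ u₂')`. -/
def freeCore : H →ₗ.[ℂ] H := freeGraph.toLinearPMap

theorem freeCore_graph : freeCore.graph = freeGraph :=
  Submodule.toLinearPMap_graph_eq _ fun x hx h0 => freeGraph_functional x hx h0

/-- The operator `L₀`, the closure of `L̃₀`. -/
def freeOp : H →ₗ.[ℂ] H := freeCore.closure

/-! ### The perturbation -/

theorem intervalIntegrable_L2 (f : L2) {ρ : ℝ} (hρ : ρ ∈ Icc (0 : ℝ) 1) :
    IntervalIntegrable f volume 0 ρ := by
  have h : IntegrableOn f (Ioo 0 1) volume := (Lp.memLp f).integrable one_le_two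
  have h' : IntegrableOn f (Ioc 0 1) volume := (integrableOn_Ioc_iff_integrableOn_Ioo).2 h
  rw [intervalIntegrable_iff_integrableOn_Ioc_of_le hρ.1]
  exact h'.mono_set (Ioc_subset_Ioc_right hρ.2)

theorem norm_integral_le_L2 (f : L2) {ρ : ℝ} (hρ : ρ ∈ Ioo (0 : ℝ) 1) :
    ‖∫ ξ in (0 : ℝ)..ρ, f ξ‖ ≤ ‖f‖ := by
  have hi : Integrable f unitMeasure := (Lp.memLp f).integrable one_le_two
  have hsub : Ioc 0 ρ ⊆ Ioo (0 : ℝ) 1 := fun x hx => ⟨hx.1, hx.2.trans_lt hρ.2⟩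
  calc ‖∫ ξ in (0 : ℝ)..ρ, f ξ‖ ≤ ∫ ξ in Ioc 0 ρ, ‖f ξ‖ :=
        (intervalIntegral.norm_integral_le_integral_norm hρ.1.le).trans
          (intervalIntegral.integral_of_le hρ.1.le).le
    _ ≤ ∫ ξ, ‖f ξ‖ ∂unitMeasure :=
        setIntegral_mono_set hi.norm (Filter.Eventually.of_forall fun _ => norm_nonneg _)
          hsub.eventuallyLE
    _ = (eLpNorm f 1 unitMeasure).toReal := by
        rw [integral_norm_eq_lintegral_enorm hi.aestronglyMeasurable,
          eLpNorm_one_eq_lintegral_enorm]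
    _ ≤ (eLpNorm f 2 unitMeasure).toReal := by
        refine ENNReal.toReal_mono (Lp.eLpNorm_ne_top f) ?_
        have : IsProbabilityMeasure unitMeasure := ⟨by simp⟩
        exact eLpNorm_le_eLpNorm_of_exponent_le one_le_two (Lp.aestronglyMeasurable f)
    _ = ‖f‖ := (Lp.norm_def f).symm

theorem memLp_primitive (f : L2) :
    MemLp (fun ρ : ℝ => ∫ ξ in (0 : ℝ)..ρ, f ξ) 2 unitMeasure := by
  have hc : ContinuousOn (fun ρ : ℝ => ∫ ξ in (0 : ℝ)..ρ, f ξ) (Icc 0 1) := by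
    have h := intervalIntegrable_L2 f (right_mem_Icc.2 zero_le_one)
    have h' := intervalIntegral.continuousOn_primitive_interval'
      (μ := volume) (a := 0) (b₁ := 0) (b₂ := 1) h left_mem_uIcc
    rwa [uIcc_of_le zero_le_one] at h'
  refine MemLp.of_bound
    ((hc.mono Ioo_subset_Icc_self).aestronglyMeasurable measurableSet_Ioo) ‖f‖ ?_
  filter_upwards [ae_restrict_mem measurableSet_Ioo] with ρ hρ
  exact norm_integral_le_L2 f hρ

theorem integral_congr_L2 {f g : ℝ → ℂ} (h : f =ᵐ[unitMeasure] g) {ρ : ℝ}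
    (hρ : ρ ∈ Ioo (0 : ℝ) 1) : ∫ ξ in (0 : ℝ)..ρ, f ξ = ∫ ξ in (0 : ℝ)..ρ, g ξ := by
  have hsub : Ioc 0 ρ ⊆ Ioo (0 : ℝ) 1 := fun x hx => ⟨hx.1, hx.2.trans_lt hρ.2⟩
  rw [intervalIntegral.integral_of_le hρ.1.le, intervalIntegral.integral_of_le hρ.1.le]
  exact integral_congr_ae (ae_restrict_of_ae_restrict_of_subset hsub h)

/-- The bounded operator `f ↦ (ρ ↦ ∫₀^ρ f(ξ) dξ)` on `L²(0,1)`. -/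
def primitiveOp : L2 →L[ℂ] L2 :=
  LinearMap.mkContinuous
    { toFun := fun f => (memLp_primitive f).toLp _
      map_add' := by
        intro f g
        rw [← MemLp.toLp_add, MemLp.toLp_eq_toLp_iff]
        filter_upwards [ae_restrict_mem measurableSet_Ioo] with ρ hρ
        rw [integral_congr_L2 (Lp.coeFn_add f g) hρ, Pi.add_apply]
        exact intervalIntegral.integral_add
          (intervalIntegrable_L2 f (Ioo_subset_Icc_self hρ))
          (intervalIntegrable_L2 g (Ioo_subset_Icc_self hρ))
      map_smul' := by
        intro c f
        rw [RingHom.id_apply, ← MemLp.toLp_const_smul, MemLp.toLp_eq_toLp_iff]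
        filter_upwards [ae_restrict_mem measurableSet_Ioo] with ρ hρ
        rw [integral_congr_L2 (Lp.coeFn_smul c f) hρ, Pi.smul_apply]
        exact intervalIntegral.integral_smul c _ }
    1 (by
      intro f
      refine (Lp.norm_le_of_ae_bound (norm_nonneg f) (C := ‖f‖) ?_).trans ?_
      · filter_upwards [ae_restrict_mem measurableSet_Ioo,
          (memLp_primitive f).coeFn_toLp] with ρ hρ h
        exact h ▸ norm_integral_le_L2 f hρ
      · simp [measureUnivNNReal])

/-- The constant `c₀ = 2(p+1)/(p-1)²`. -/
def c₀ (p : ℕ) : ℝ := 2 * ((p : ℝ) + 1) / ((p : ℝ) - 1) ^ 2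

/-- The bounded operator `L' u = (p c₀ ∫₀^ρ u₂(ξ) dξ, 0)` on `ℋ`. -/
def pertOp (p : ℕ) : H →L[ℂ] H :=
  ((p * c₀ p : ℝ) : ℂ) •
    ((WithLp.prodContinuousLinearEquiv 2 ℂ L2 L2).symm.toContinuousLinearMap ∘L
      ContinuousLinearMap.inl ℂ L2 L2 ∘L primitiveOp ∘L
      ContinuousLinearMap.snd ℂ L2 L2 ∘L
      (WithLp.prodContinuousLinearEquiv 2 ℂ L2 L2).toContinuousLinearMap)

theorem pertOp_fst (p : ℕ) (u : H) :
    (pertOp p u).fst =ᵐ[unitMeasure]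
      fun ρ => ((p * c₀ p : ℝ) : ℂ) * ∫ ξ in (0 : ℝ)..ρ, u.snd ξ := by
  have h : (pertOp p u).fst = ((p * c₀ p : ℝ) : ℂ) • (memLp_primitive u.snd).toLp _ := rfl
  rw [h]
  exact (Lp.coeFn_smul _ _).trans ((memLp_primitive u.snd).coeFn_toLp.const_smul _)

theorem pertOp_snd (p : ℕ) (u : H) : (pertOp p u).snd = 0 := by
  have h : (pertOp p u).snd = ((p * c₀ p : ℝ) : ℂ) • (0 : L2) := rfl
  rw [h, smul_zero]

/-- The operator `L = L₀ + L'`, with domain `D(L) = D(L₀)`. -/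
def fullOp (p : ℕ) : H →ₗ.[ℂ] H := (pertOp p : H →ₗ[ℂ] H) +ᵥ freeOp

end SimilarityWave

end

/-! The spectrum of `freeOp` is the closed half-plane `Re z ≤ 1/2`. To the right of the line,
integration by parts gives `Re ⟨u, L₀ u⟩ ≤ ‖u‖² / 2` (`integral_dissipative`), so `z - L₀` is
bounded below and only density of its range is needed. To the left, extending `u₁` oddly and `u₂`
evenly to `[-1,1]` turns `L₀` into `(1 - s) d/ds` acting on `W = u₁ + u₂`; its formal eigenfunction
`(1 - s)^(-z)` is square integrable for `Re z < 1/2`, and shifting the singularity to `1 + ε` gives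
approximate eigenvectors (`exists_approx_eigenvector`). Openness of the resolvent set settles the
line itself.

Density of ranges is algebra. On odd powers in the first slot and even powers in the second, `z - L₀
- L'` is block triangular with 2×2 blocks of determinant `(z + 2m + 1)(z + 2m) - p c₀`, and these
pairs span a dense subspace (`dense_range_of_monomial_mem`).

The two operators are linked by compactness of `L'`: if `z` is a resolvent point of `A` and `B` is
compact, a dense range of `z - A - B` already forces invertibility
(`mem_opResolventSet_vadd_of_dense`). With `A = L₀`, `B = L'` this leaves, for `Re z > 1/2`, only
the zero `1 + 2/(p-1)` of the `m = 0` determinant, where the kernel of the block yields an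
eigenvector. With `A = L`, `B = -L'` it shows that no resolvent point of `L` lies in `Re z ≤ 1/2`,
so `ρ(L) ⊆ ρ(L₀)`; claim 1 is then the factorization `z - L = (1 - L' R)(z - L₀)`. -/

namespace SimilarityWave

/-! ### Compact operators and the Fredholm alternative -/

section Compact

variable {E : Type*} [NormedAddCommGroup E] [InnerProductSpace ℂ E] [CompleteSpace E]

/-- Schauder's theorem in a Hilbert space: the adjoint of a compact operator is compact. -/
theorem isCompactOperator_adjoint {T : E →L[ℂ] E} (hT : IsCompactOperator T) :
    IsCompactOperator (ContinuousLinearMap.adjoint T) := by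
  set S := ContinuousLinearMap.adjoint T with hS
  have hTS : IsCompactOperator (T ∘L S) := hT.comp_clm S
  have hc := hTS.isCompact_closure_image_ball (𝕜₁ := ℂ) (f := ((T ∘L S : E →L[ℂ] E) : E →ₗ[ℂ] E)) 1
  have htb : TotallyBounded ((T ∘L S) '' Metric.ball 0 1) := hc.totallyBounded.subset subset_closure
  refine (isCompactOperator_iff_isCompact_closure_image_ball (𝕜₁ := ℂ)
    (S : E →ₗ[ℂ] E) zero_lt_one).2 ?_
  refine TotallyBounded.isCompact_of_isClosed (TotallyBounded.closure ?_) isClosed_closure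
  rw [Metric.totallyBounded_iff]
  intro ε hε
  -- The radius is `ε² / 2` because `‖S w‖² ≤ ‖T S w‖ ‖w‖` with `‖w‖ ≤ 2` for a difference `w` of
  -- points of the unit ball.
  obtain ⟨t, hts, htf, hcov⟩ := Metric.finite_approx_of_totallyBounded htb (ε ^ 2 / 2) (by positivity)
  have hts' : ∀ y ∈ t, ∃ x ∈ Metric.ball (0 : E) 1, (T ∘L S) x = y := fun y hy => hts hy
  choose! g hg hgt using hts'
  refine ⟨(fun y => S (g y)) '' t, htf.image _, ?_⟩
  rintro _ ⟨x, hx, rfl⟩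
  obtain ⟨y, hy, hxy⟩ := mem_iUnion₂.1 (hcov (mem_image_of_mem _ hx))
  refine mem_iUnion₂.2 ⟨_, mem_image_of_mem _ hy, ?_⟩
  rw [Metric.mem_ball, dist_eq_norm] at hxy ⊢
  rw [← hgt y hy, ← map_sub] at hxy
  change ‖S x - S (g y)‖ < ε
  rw [← map_sub]
  have h1 : ‖S (x - g y)‖ ^ 2 ≤ ‖(T ∘L S) (x - g y)‖ * ‖x - g y‖ := by
    have : (inner ℂ (S (x - g y)) (S (x - g y)) : ℂ) = inner ℂ ((T ∘L S) (x - g y)) (x - g y) := by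
      rw [hS, ContinuousLinearMap.adjoint_inner_right]; rfl
    rw [← inner_self_eq_norm_sq (𝕜 := ℂ), this]
    exact (RCLike.re_le_norm _).trans (norm_inner_le_norm _ _)
  have h2 : ‖x - g y‖ ≤ 2 := by
    have a := mem_ball_zero_iff.1 hx
    have b := mem_ball_zero_iff.1 (hg y hy)
    linarith [norm_sub_le x (g y)]
  have h3 : ‖S (x - g y)‖ ^ 2 < ε ^ 2 := by
    nlinarith [norm_nonneg ((T ∘L S) (x - g y))]
  exact lt_of_pow_lt_pow_left₀ 2 hε.le h3

/-- If `K` is compact and `1 - K` has dense range, then `1 - K` is invertible. -/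
theorem isUnit_one_sub_of_denseRange {K : E →L[ℂ] E} (hK : IsCompactOperator K)
    (hd : DenseRange (1 - K : E →L[ℂ] E)) : IsUnit (1 - K) := by
  -- Fredholm alternative for the adjoint: a fixed vector of `K*` would be orthogonal to the dense
  -- range of `1 - K`.
  rcases (isCompactOperator_adjoint hK).hasEigenvalue_or_mem_resolventSet (one_ne_zero (α := ℂ)) with h | h
  · obtain ⟨v, hv⟩ := h.exists_hasEigenvector
    have hv1 : ContinuousLinearMap.adjoint K v = v := by simpa using hv.apply_eq_smul
    refine absurd (hd.eq_zero_of_inner_left (𝕜 := ℂ) (x := v) fun x => ?_) hv.2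
    have e : inner ℂ v (K x) = inner ℂ v x := by
      rw [← ContinuousLinearMap.adjoint_inner_left, hv1]
    change inner ℂ v (x - K x) = 0
    rw [inner_sub_right, e, sub_self]
  · rw [spectrum.mem_resolventSet_iff, map_one] at h
    have h' := h.star
    rwa [star_sub, star_one, ContinuousLinearMap.star_eq_adjoint,
      ContinuousLinearMap.adjoint_adjoint] at h'

end Compact

/-! ### Perturbation of resolvents -/

section Perturbation

variable {E : Type*} [NormedAddCommGroup E] [NormedSpace ℂ E]

/-- The graph form removes the domain subtypes; adding a bounded operator then becomes a shear of
the graph. -/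
theorem isResolventAt_iff_graph {A : E →ₗ.[ℂ] E} {z : ℂ} {R : E →L[ℂ] E} :
    IsResolventAt A z R ↔ (∀ f, (R f, z • R f - f) ∈ A.graph) ∧
      ∀ x ∈ A.graph, R (z • x.1 - x.2) = x.1 := by
  simp only [IsResolventAt, LinearPMap.mem_graph_iff]
  refine and_congr (forall_congr' fun f => ?_) ⟨?_, ?_⟩
  · refine exists_congr fun u => and_congr_right fun hu => ?_
    rw [hu]
    constructor <;> intro h
    · have e := sub_sub_cancel (z • R f) (A u)
      rw [h] at e
      exact e.symm
    · rw [h]; simp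
  · rintro h x ⟨y, hy, hy'⟩
    rw [← hy, ← hy', h]
  · intro h u
    exact h (u, A u) ⟨u, rfl, rfl⟩

theorem mem_graph_vadd {A : E →ₗ.[ℂ] E} {B : E →L[ℂ] E} {x : E × E} :
    x ∈ ((B : E →ₗ[ℂ] E) +ᵥ A).graph ↔ (x.1, x.2 - B x.1) ∈ A.graph := by
  simp only [LinearPMap.mem_graph_iff]
  constructor
  · rintro ⟨y, hy, hy'⟩
    refine ⟨y, hy, ?_⟩
    rw [← hy', ← hy, LinearPMap.vadd_apply]
    simp
  · rintro ⟨y, hy, hy'⟩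
    refine ⟨y, hy, ?_⟩
    rw [LinearPMap.vadd_apply, hy']
    simp [hy]

/-- Invert the factorization `z - A - B = (1 - B R)(z - A)`. -/
theorem isResolventAt_vadd {A : E →ₗ.[ℂ] E} {B R S : E →L[ℂ] E} {z : ℂ}
    (hR : IsResolventAt A z R) (h1 : (1 - B * R) * S = 1) (h2 : S * (1 - B * R) = 1) :
    IsResolventAt ((B : E →ₗ[ℂ] E) +ᵥ A) z (R * S) := by
  rw [isResolventAt_iff_graph] at hR ⊢
  refine ⟨fun f => mem_graph_vadd.2 ?_, fun x hx => ?_⟩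
  · have := hR.1 (S f)
    have e : S f - B (R (S f)) = f := by simpa using DFunLike.congr_fun h1 f
    have e' : z • R (S f) - f - B (R (S f)) = z • R (S f) - S f := by
      nth_rw 2 [← e]
      abel
    rwa [← e'] at this
  · have h := hR.2 _ (mem_graph_vadd.1 hx)
    set g := z • x.1 - (x.2 - B x.1) with hg
    have : z • x.1 - x.2 = (1 - B * R) g := by
      have h' : B (R g) = B x.1 := by rw [h]
      change _ = g - B (R g)
      rw [h', hg]
      abel
    have e : S ((1 - B * R) g) = g := by simpa using DFunLike.congr_fun h2 g
    rw [mul_apply_eq_comp, this, e, h]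

theorem isUnit_of_isResolventAt_vadd {A : E →ₗ.[ℂ] E} {B R R' : E →L[ℂ] E} {z : ℂ}
    (hR : IsResolventAt A z R) (hR' : IsResolventAt ((B : E →ₗ[ℂ] E) +ᵥ A) z R') :
    IsUnit (1 - B * R) := by
  rw [isResolventAt_iff_graph] at hR hR'
  -- The inverse comes from the second resolvent identity `R' = R (1 + B R')`.
  refine isUnit_iff_exists.2 ⟨1 + B * R', ?_, ?_⟩
  · ext f
    have h := hR.2 _ (mem_graph_vadd.1 (hR'.1 f))
    simp only [] at h
    have e : z • R' f - (z • R' f - f - B (R' f)) = f + B (R' f) := by abel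
    rw [e] at h
    simp [h]
  · ext f
    have h := hR'.2 (R f, z • R f - f + B (R f)) (mem_graph_vadd.2 (by simpa using hR.1 f))
    simp only [] at h
    have e : z • R f - (z • R f - f + B (R f)) = f - B (R f) := by abel
    rw [e] at h
    simp [h]

theorem mem_opResolventSet_vadd_of_isUnit {A : E →ₗ.[ℂ] E} {B R : E →L[ℂ] E} {z : ℂ}
    (hR : IsResolventAt A z R) (h : IsUnit (1 - B * R)) :
    z ∈ opResolventSet ((B : E →ₗ[ℂ] E) +ᵥ A) := by
  obtain ⟨S, h1, h2⟩ := isUnit_iff_exists.1 h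
  exact ⟨_, isResolventAt_vadd hR h1 h2⟩

theorem mem_opResolventSet_vadd_iff {A : E →ₗ.[ℂ] E} {B : E →L[ℂ] E} {z : ℂ}
    (hz : z ∈ opResolventSet A) :
    z ∈ opResolventSet ((B : E →ₗ[ℂ] E) +ᵥ A) ↔ IsUnit (1 - B * opResolvent A z) :=
  ⟨fun ⟨_, h⟩ => isUnit_of_isResolventAt_vadd (opResolvent_spec hz) h,
    mem_opResolventSet_vadd_of_isUnit (opResolvent_spec hz)⟩

/-- Moving the spectral parameter is a bounded perturbation, `w - A = z - (A + (z - w))`, and units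
form an open set. -/
theorem isOpen_opResolventSet [CompleteSpace E] (A : E →ₗ.[ℂ] E) : IsOpen (opResolventSet A) := by
  rw [isOpen_iff_mem_nhds]
  rintro z ⟨R, hR⟩
  have hc : Continuous fun w : ℂ => 1 - ((z - w) • (1 : E →L[ℂ] E)) * R := by fun_prop
  have hu : ∀ᶠ w in nhds z, IsUnit (1 - ((z - w) • (1 : E →L[ℂ] E)) * R) := by
    refine hc.continuousAt.eventually (Units.isOpen.mem_nhds ?_)
    simp
  filter_upwards [hu] with w hw
  obtain ⟨R', hR'⟩ := mem_opResolventSet_vadd_of_isUnit hR hw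
  refine ⟨R', ?_⟩
  rw [isResolventAt_iff_graph] at hR' ⊢
  refine ⟨fun f => ?_, fun x hx => ?_⟩
  · have := mem_graph_vadd.1 (hR'.1 f)
    convert this using 2
    simp [sub_smul]
  · have := hR'.2 (x.1, x.2 + (z - w) • x.1) (mem_graph_vadd.2 (by simpa using hx))
    simp only [] at this
    have e : z • x.1 - (x.2 + (z - w) • x.1) = w • x.1 - x.2 := by
      rw [sub_smul]
      abel
    rwa [e] at this

end Perturbation

/-! ### Compact perturbations with dense range -/

section DenseRange

variable {E : Type*} [NormedAddCommGroup E] [InnerProductSpace ℂ E] [CompleteSpace E]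

/-- If `B` is compact, `z ∈ ρ(A)` and `z - (A + B)` has dense range, then `z ∈ ρ(A + B)`. -/
theorem mem_opResolventSet_vadd_of_dense {A : E →ₗ.[ℂ] E} {B : E →L[ℂ] E} {z : ℂ}
    (hB : IsCompactOperator B) (hz : z ∈ opResolventSet A)
    (hd : Dense {f | ∃ x ∈ ((B : E →ₗ[ℂ] E) +ᵥ A).graph, z • x.1 - x.2 = f}) :
    z ∈ opResolventSet ((B : E →ₗ[ℂ] E) +ᵥ A) := by
  obtain ⟨R, hR⟩ := hz
  refine mem_opResolventSet_vadd_of_isUnit hR (isUnit_one_sub_of_denseRange (hB.comp_clm R) ?_)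
  -- Since `(1 - B R)(z - A) x = (z - A - B) x`, the range of `1 - B R` contains the given dense
  -- set.
  refine hd.mono ?_
  rintro _ ⟨x, hx, rfl⟩
  have h := (isResolventAt_iff_graph.1 hR).2 _ (mem_graph_vadd.1 hx)
  refine ⟨z • x.1 - (x.2 - B x.1), ?_⟩
  have e : (1 - B * R) (z • x.1 - (x.2 - B x.1)) =
    z • x.1 - (x.2 - B x.1) - B (R (z • x.1 - (x.2 - B x.1))) := rfl
  rw [e, h]
  abel

end DenseRange


/-! ### Square integrable functions on the unit interval -/

/-- The element of `ℋ` represented by a pair of square integrable functions. -/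
noncomputable def pairH {f g : ℝ → ℂ} (hf : MemLp f 2 unitMeasure) (hg : MemLp g 2 unitMeasure) :
    H :=
  WithLp.toLp 2 (hf.toLp f, hg.toLp g)

theorem pairH_fst {f g : ℝ → ℂ} (hf : MemLp f 2 unitMeasure) (hg : MemLp g 2 unitMeasure) :
    (pairH hf hg).fst =ᵐ[unitMeasure] f := hf.coeFn_toLp

theorem pairH_snd {f g : ℝ → ℂ} (hf : MemLp f 2 unitMeasure) (hg : MemLp g 2 unitMeasure) :
    (pairH hf hg).snd =ᵐ[unitMeasure] g := hg.coeFn_toLp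

theorem H_ext {u v : H} (h1 : u.fst =ᵐ[unitMeasure] v.fst) (h2 : u.snd =ᵐ[unitMeasure] v.snd) :
    u = v :=
  WithLp.ofLp_injective 2 (Prod.ext (Lp.ext h1) (Lp.ext h2))

theorem memLp_of_continuousOn {f : ℝ → ℂ} (hf : ContinuousOn f (Icc 0 1)) :
    MemLp f 2 unitMeasure := by
  obtain ⟨C, hC⟩ := isCompact_Icc.exists_bound_of_continuousOn hf
  refine MemLp.of_bound
    ((hf.mono Ioo_subset_Icc_self).aestronglyMeasurable measurableSet_Ioo) C ?_
  filter_upwards [ae_restrict_mem measurableSet_Ioo] with ρ hρ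
  exact hC ρ (Ioo_subset_Icc_self hρ)

theorem H_norm_le (u : H) : ‖u‖ ≤ ‖u.fst‖ + ‖u.snd‖ := by
  rw [WithLp.prod_norm_eq_of_L2]
  exact Real.sqrt_le_iff.2 ⟨by positivity, by nlinarith [norm_nonneg u.fst, norm_nonneg u.snd]⟩

/-! ### Compactness of the perturbation -/

/-- Cauchy–Schwarz against an indicator. The resulting Hölder-1/2 modulus of primitives makes the
step approximations converge in operator norm. -/
theorem norm_intervalIntegral_le_sqrt (f : L2) {a b : ℝ} (ha : 0 ≤ a) (hab : a ≤ b) (hb : b < 1) :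
    ‖∫ ξ in a..b, f ξ‖ ≤ ‖f‖ * √(b - a) := by
  have hsub : Ioc a b ⊆ Ioo (0 : ℝ) 1 := fun x hx => ⟨ha.trans_lt hx.1, hx.2.trans_lt hb⟩
  have hne : unitMeasure (Ioc a b) ≠ ⊤ := measure_ne_top _ _
  have e : ∫ ξ in a..b, f ξ = inner ℂ (indicatorConstLp 2 measurableSet_Ioc hne (1 : ℂ)) f := by
    rw [L2.inner_indicatorConstLp_one, intervalIntegral.integral_of_le hab,
      Measure.restrict_restrict measurableSet_Ioc, inter_eq_left.2 hsub]
  rw [e, mul_comm]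
  refine (norm_inner_le_norm _ _).trans_eq ?_
  rw [norm_indicatorConstLp (by norm_num) (by norm_num)]
  congr 1
  rw [Measure.real, Measure.restrict_apply measurableSet_Ioc, inter_eq_left.2 hsub]
  simp [Real.sqrt_eq_rpow, hab]

/-- The finite rank approximation of `primitiveOp` by step functions with `n` steps. -/
noncomputable def stepOp (n : ℕ) : L2 →L[ℂ] L2 :=
  ∑ k ∈ Finset.range n,
    (innerSL ℂ (indicatorConstLp (μ := unitMeasure) 2 (measurableSet_Ioc (a := (0 : ℝ)) (b := k / n))
      (measure_ne_top _ _) (1 : ℂ))).smulRight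
    (indicatorConstLp (μ := unitMeasure) 2 (measurableSet_Ico (a := (k / n : ℝ)) (b := (k + 1) / n))
      (measure_ne_top _ _) (1 : ℂ))

theorem isCompactOperator_smulRight {E : Type*} [NormedAddCommGroup E] [NormedSpace ℂ E]
    (f : E →L[ℂ] ℂ) (v : E) : IsCompactOperator (f.smulRight v) :=
  (isCompactOperator_of_locallyCompactSpace_rng (ContinuousLinearMap.toSpanSingleton ℂ v)).comp_clm f

theorem isCompactOperator_stepOp (n : ℕ) : IsCompactOperator (stepOp n) := by
  have h : stepOp n ∈ compactOperator (RingHom.id ℂ) L2 L2 :=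
    Submodule.sum_mem _ fun k _ => isCompactOperator_smulRight _ _
  exact h

/-- Exactly one grid cell contains `ρ`, the one with index `⌊nρ⌋`, so the sum evaluates the
primitive at the left end of that cell. -/
theorem stepOp_ae {n : ℕ} (hn : 0 < n) (f : L2) : stepOp n f =ᵐ[unitMeasure]
    fun ρ => ∫ ξ in (0 : ℝ)..(⌊n * ρ⌋₊ / n : ℝ), f ξ := by
  have hn' : (0 : ℝ) < n := by exact_mod_cast hn
  have e : stepOp n f = ∑ k ∈ Finset.range n, (∫ ξ in (0 : ℝ)..(k / n : ℝ), f ξ) •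
      (indicatorConstLp (μ := unitMeasure) 2 (measurableSet_Ico (a := (k / n : ℝ))
        (b := (k + 1) / n)) (measure_ne_top _ _) (1 : ℂ)) := by
    rw [stepOp, sum_apply]
    refine Finset.sum_congr rfl fun k hk => ?_
    rw [ContinuousLinearMap.smulRight_apply, innerSL_apply_apply, L2.inner_indicatorConstLp_one,
      Measure.restrict_restrict measurableSet_Ioc, intervalIntegral.integral_of_le (by positivity)]
    congr 3
    refine inter_eq_left.2 fun x hx => ⟨hx.1, hx.2.trans_lt ?_⟩
    rw [div_lt_one hn']
    exact_mod_cast Finset.mem_range.1 hk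
  rw [e]
  refine (Lp.coeFn_fun_finsetSum _ _).trans ?_
  have h1 : ∀ k ∈ Finset.range n, ((∫ ξ in (0 : ℝ)..(k / n : ℝ), f ξ) •
      (indicatorConstLp (μ := unitMeasure) 2 (measurableSet_Ico (a := (k / n : ℝ))
        (b := (k + 1) / n)) (measure_ne_top _ _) (1 : ℂ)) : L2) =ᵐ[unitMeasure]
      fun ρ => if ⌊n * ρ⌋₊ = k then ∫ ξ in (0 : ℝ)..(⌊n * ρ⌋₊ / n : ℝ), f ξ else 0 := by
    intro k _
    refine (Lp.coeFn_smul _ _).trans ?_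
    filter_upwards [indicatorConstLp_coeFn (p := 2) (hs := measurableSet_Ico
      (a := (k / n : ℝ)) (b := (k + 1) / n)) (hμs := measure_ne_top unitMeasure _) (c := (1 : ℂ)),
      ae_restrict_mem measurableSet_Ioo] with ρ hρ h01
    have hiff : ρ ∈ Ico (k / n : ℝ) ((k + 1) / n) ↔ ⌊n * ρ⌋₊ = k := by
      rw [Nat.floor_eq_iff (by have := h01.1; positivity), mem_Ico, div_le_iff₀ hn',
        lt_div_iff₀ hn', mul_comm ρ]
    rw [Pi.smul_apply, hρ]
    by_cases h : ⌊n * ρ⌋₊ = k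
    · rw [if_pos h, indicator_of_mem (hiff.2 h), h, smul_eq_mul, mul_one]
    · rw [if_neg h, indicator_of_notMem (fun h' => h (hiff.1 h')), smul_zero]
  have h2 : ∀ᵐ ρ ∂unitMeasure, ∀ k ∈ Finset.range n, ((∫ ξ in (0 : ℝ)..(k / n : ℝ), f ξ) •
      (indicatorConstLp (μ := unitMeasure) 2 (measurableSet_Ico (a := (k / n : ℝ))
        (b := (k + 1) / n)) (measure_ne_top _ _) (1 : ℂ)) : L2) ρ =
      if ⌊n * ρ⌋₊ = k then ∫ ξ in (0 : ℝ)..(⌊n * ρ⌋₊ / n : ℝ), f ξ else 0 :=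
    (ae_ball_iff (Finset.range n).countable_toSet).2 h1
  filter_upwards [h2, ae_restrict_mem measurableSet_Ioo] with ρ hρ h01
  rw [Finset.sum_congr rfl hρ, Finset.sum_ite_eq, if_pos]
  rw [Finset.mem_range, Nat.floor_lt (by have := h01.1; positivity)]
  nlinarith [h01.2]

theorem isCompactOperator_primitiveOp : IsCompactOperator primitiveOp := by
  refine isCompactOperator_of_tendsto (l := Filter.atTop) (F := stepOp) ?_
    (Filter.Eventually.of_forall isCompactOperator_stepOp)
  rw [tendsto_iff_norm_sub_tendsto_zero]
  have hlim : Filter.Tendsto (fun n : ℕ => √(1 / (n : ℝ))) Filter.atTop (nhds 0) := by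
    have := (Real.continuous_sqrt.tendsto 0).comp (tendsto_one_div_atTop_nhds_zero_nat (𝕜 := ℝ))
    rwa [Real.sqrt_zero] at this
  refine squeeze_zero' (Filter.Eventually.of_forall fun _ => norm_nonneg _) ?_ hlim
  filter_upwards [Filter.eventually_gt_atTop 0] with n hn
  have hn' : (0 : ℝ) < n := by exact_mod_cast hn
  refine ContinuousLinearMap.opNorm_le_bound _ (Real.sqrt_nonneg _) fun f => ?_
  refine (Lp.norm_le_of_ae_bound (C := √(1 / (n : ℝ)) * ‖f‖) (by positivity) ?_).trans ?_
  · filter_upwards [ae_restrict_mem measurableSet_Ioo, stepOp_ae hn f,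
      (memLp_primitive f).coeFn_toLp, Lp.coeFn_sub (stepOp n f) (primitiveOp f)] with ρ hρ h1 h2 h3
    have h2' : primitiveOp f ρ = ∫ ξ in (0 : ℝ)..ρ, f ξ := h2
    have hle : (⌊n * ρ⌋₊ / n : ℝ) ≤ ρ := by
      rw [div_le_iff₀ hn', mul_comm]
      exact Nat.floor_le (by have := hρ.1; positivity)
    have h0 : (0 : ℝ) ≤ (⌊n * ρ⌋₊ / n : ℝ) := by positivity
    have hgt : ρ - (⌊n * ρ⌋₊ / n : ℝ) ≤ 1 / n := by
      have := Nat.lt_floor_add_one (n * ρ)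
      rw [sub_le_iff_le_add, ← add_div, le_div_iff₀ hn']
      linarith
    rw [sub_apply, h3, Pi.sub_apply, h1, h2', norm_sub_rev,
      intervalIntegral.integral_interval_sub_left
        (intervalIntegrable_L2 f (Ioo_subset_Icc_self hρ))
        (intervalIntegrable_L2 f ⟨h0, hle.trans hρ.2.le⟩), mul_comm (√(1 / (n : ℝ)))]
    refine (norm_intervalIntegral_le_sqrt f h0 hle hρ.2).trans ?_
    gcongr
  · simp [measureUnivNNReal]

theorem isCompactOperator_pertOp (p : ℕ) : IsCompactOperator (pertOp p) := by
  have h := ((isCompactOperator_primitiveOp.comp_clm (ContinuousLinearMap.snd ℂ L2 L2 ∘L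
    (WithLp.prodContinuousLinearEquiv 2 ℂ L2 L2).toContinuousLinearMap)).clm_comp
      (ContinuousLinearMap.inl ℂ L2 L2)).clm_comp
        (WithLp.prodContinuousLinearEquiv 2 ℂ L2 L2).symm.toContinuousLinearMap
  exact h.smul ((p * c₀ p : ℝ) : ℂ)

/-! ### Dissipativity of the free operator -/

theorem hasDerivAt_D {v : ℝ → ℂ} (hv : ContDiffOn ℝ 1 v (Icc 0 1)) {ρ : ℝ}
    (hρ : ρ ∈ Ioo (0 : ℝ) 1) : HasDerivAt v (D v ρ) ρ :=
  (hv.differentiableOn one_ne_zero ρ (Ioo_subset_Icc_self hρ)).hasDerivWithinAt.hasDerivAt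
    (Icc_mem_nhds hρ.1 hρ.2)

/-- The integrand is the exact derivative of `-ρ/2 (|v₁|² + |v₂|²) + Re ⟨v₁, v₂⟩`. This vanishes at
`0` because `v₁ 0 = 0`, and equals `-|v₁ - v₂|² / 2` at `1`. -/
theorem integral_dissipative {v₁ v₂ : ℝ → ℂ} (hv : IsC1Pair v₁ v₂) :
    ∫ ρ in (0 : ℝ)..1, (inner ℝ (v₁ ρ) (-(ρ : ℂ) * D v₁ ρ + D v₂ ρ) +
      inner ℝ (v₂ ρ) (D v₁ ρ - (ρ : ℂ) * D v₂ ρ) - (‖v₁ ρ‖ ^ 2 + ‖v₂ ρ‖ ^ 2) / 2) ≤ 0 := by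
  obtain ⟨h1, h2, h0⟩ := hv
  have c1 := h1.continuousOn
  have c2 := h2.continuousOn
  have d1 : ContinuousOn (D v₁) (Icc 0 1) :=
    h1.continuousOn_derivWithin (uniqueDiffOn_Icc zero_lt_one) le_rfl
  have d2 : ContinuousOn (D v₂) (Icc 0 1) :=
    h2.continuousOn_derivWithin (uniqueDiffOn_Icc zero_lt_one) le_rfl
  have key := intervalIntegral.integral_eq_sub_of_hasDerivAt_of_le (a := 0) (b := 1) zero_le_one
    (f := fun ρ => -ρ / 2 * (‖v₁ ρ‖ ^ 2 + ‖v₂ ρ‖ ^ 2) + inner ℝ (v₁ ρ) (v₂ ρ))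
    (f' := fun ρ => inner ℝ (v₁ ρ) (-(ρ : ℂ) * D v₁ ρ + D v₂ ρ) +
      inner ℝ (v₂ ρ) (D v₁ ρ - (ρ : ℂ) * D v₂ ρ) - (‖v₁ ρ‖ ^ 2 + ‖v₂ ρ‖ ^ 2) / 2)
    (by fun_prop) ?_ ?_
  · rw [key]
    simp only [h0]
    have := norm_sub_sq_real (v₁ 1) (v₂ 1)
    simp only [inner_zero_left, neg_zero, zero_div, zero_mul, add_zero, sub_zero]
    nlinarith [sq_nonneg ‖v₁ 1 - v₂ 1‖]
  · intro ρ hρ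
    have e1 := hasDerivAt_D h1 hρ
    have e2 := hasDerivAt_D h2 hρ
    refine ((((hasDerivAt_id ρ).neg.div_const 2).mul (e1.norm_sq.add e2.norm_sq)).add
      (e1.inner ℝ e2)).congr_deriv ?_
    simp only [Complex.inner, Pi.add_apply, Pi.neg_apply, id]
    simp
    ring
  · apply ContinuousOn.intervalIntegrable
    rw [uIcc_of_le zero_le_one]
    have : ContinuousOn (fun ρ : ℝ => (ρ : ℂ)) (Icc 0 1) := Complex.continuous_ofReal.continuousOn
    fun_prop

theorem re_inner_L2 (f g : L2) : (inner ℂ f g).re = ∫ ρ, inner ℝ (f ρ) (g ρ) ∂unitMeasure := by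
  rw [L2.inner_def]
  exact (integral_re (L2.integrable_inner (𝕜 := ℂ) f g)).symm

theorem re_inner_freeGraph_le {x : H × H} (hx : x ∈ freeGraph) :
    (inner ℂ x.1 x.2).re ≤ 1 / 2 * ‖x.1‖ ^ 2 := by
  obtain ⟨v₁, v₂, hv, h1, h2, h3, h4⟩ := hx
  have hi : ∀ f g : L2, Integrable (fun ρ => inner ℝ (f ρ) (g ρ)) unitMeasure := fun f g =>
    (L2.integrable_inner (𝕜 := ℂ) f g).re
  have hi' : ∀ f g f' g' : L2, Integrable (fun ρ => inner ℝ (f ρ) (g ρ) + inner ℝ (f' ρ) (g' ρ))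
      unitMeasure := fun f g f' g' => (hi f g).add (hi f' g')
  have hn : ∀ f : L2, ‖f‖ ^ 2 = (inner ℂ f f).re := fun f =>
    (inner_self_eq_norm_sq (𝕜 := ℂ) f).symm
  rw [WithLp.prod_norm_sq_eq_of_L2, WithLp.prod_inner_apply, Complex.add_re, hn, hn, ← sub_nonpos,
    re_inner_L2, re_inner_L2, re_inner_L2, re_inner_L2, ← integral_add (hi _ _) (hi _ _),
    ← integral_add (hi _ _) (hi _ _), ← integral_const_mul,
    ← integral_sub (hi' _ _ _ _) ((hi' _ _ _ _).const_mul _)]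
  refine (le_of_eq ?_).trans (integral_dissipative hv)
  rw [intervalIntegral.integral_of_le zero_le_one, integral_Ioc_eq_integral_Ioo]
  refine integral_congr_ae ?_
  filter_upwards [h1, h2, h3, h4] with ρ e1 e2 e3 e4
  simp only [WithLp.fst, WithLp.snd] at e1 e2 e3 e4
  simp only [WithLp.fst, WithLp.snd, e1, e2, e3, e4, real_inner_self_eq_norm_sq]
  ring


/-! ### Dissipative operators -/

section Dissipative

variable {E : Type*} [NormedAddCommGroup E] [InnerProductSpace ℂ E]

/-- Cauchy–Schwarz applied to `Re ⟨u, z u - w⟩ ≥ (Re z - ω) ‖u‖²`; the case `u = 0` is separate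
since one divides by `‖u‖`. -/
theorem norm_le_of_re_inner_le {u w : E} {ω : ℝ} (h : (inner ℂ u w).re ≤ ω * ‖u‖ ^ 2) (z : ℂ) :
    (z.re - ω) * ‖u‖ ≤ ‖z • u - w‖ := by
  rcases (norm_nonneg u).eq_or_lt with h0 | h0
  · rw [← h0, mul_zero]
    exact norm_nonneg _
  · have h1 : (inner ℂ u (z • u - w)).re = z.re * ‖u‖ ^ 2 - (inner ℂ u w).re := by
      rw [inner_sub_right, inner_smul_right, inner_self_eq_norm_sq_to_K, Complex.sub_re]
      have e : ((‖u‖ : ℂ) ^ 2) = ((‖u‖ ^ 2 : ℝ) : ℂ) := by push_cast; rfl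
      congr 1
      exact (congrArg (fun t => (z * t).re) e).trans (Complex.re_mul_ofReal z _)
    have h2 : (inner ℂ u (z • u - w)).re ≤ ‖u‖ * ‖z • u - w‖ :=
      (Complex.re_le_norm _).trans (norm_inner_le_norm _ _)
    nlinarith

theorem re_inner_le_of_mem_closure {G : Submodule ℂ (E × E)} {ω : ℝ}
    (h : ∀ x ∈ G, (inner ℂ x.1 x.2).re ≤ ω * ‖x.1‖ ^ 2) {x : E × E}
    (hx : x ∈ G.topologicalClosure) : (inner ℂ x.1 x.2).re ≤ ω * ‖x.1‖ ^ 2 := by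
  have hc : IsClosed {x : E × E | (inner ℂ x.1 x.2).re ≤ ω * ‖x.1‖ ^ 2} :=
    isClosed_le (Complex.continuous_re.comp (continuous_fst.inner continuous_snd)) (by fun_prop)
  exact closure_minimal h hc hx

/-- A densely defined quasi-dissipative operator is closable. -/
theorem isClosable_of_dissipative {A : E →ₗ.[ℂ] E} {ω : ℝ} (hd : Dense (A.domain : Set E))
    (h : ∀ x ∈ A.graph, (inner ℂ x.1 x.2).re ≤ ω * ‖x.1‖ ^ 2) : A.IsClosable := by
  refine ⟨A.graph.topologicalClosure.toLinearPMap, (Submodule.toLinearPMap_graph_eq _ ?_).symm⟩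
  intro x hx hx0
  refine hd.eq_zero_of_inner_right (𝕜 := ℂ) fun u hu => ?_
  by_contra ha
  have hu' : (u, A ⟨u, hu⟩) ∈ A.graph.topologicalClosure :=
    A.graph.le_topologicalClosure (A.mem_graph ⟨u, hu⟩)
  have h1 := fun t : ℂ => re_inner_le_of_mem_closure h (add_mem hu' (Submodule.smul_mem _ t hx))
  -- If `(0, a)` lies in the closed graph, adding `t (0, a)` to `(u, A u)` leaves `u` fixed but
  -- shifts the inner product by `t ⟨u, a⟩`. This `t` overshoots the dissipativity bound by exactly
  -- `1`.
  have h2 := h1 (((ω * ‖u‖ ^ 2 - (inner ℂ u (A ⟨u, hu⟩)).re + 1 : ℝ) : ℂ) / inner ℂ u x.2)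
  simp only [Prod.fst_add, Prod.snd_add, Prod.smul_fst, Prod.smul_snd, hx0, smul_zero, add_zero,
    inner_add_right, inner_smul_right, div_mul_cancel₀ _ ha, Complex.add_re,
    Complex.ofReal_re] at h2
  linarith

variable [CompleteSpace E]

/-- A closed quasi-dissipative operator has `z` in its resolvent set if `z - A` has dense range and
`Re z` is larger than the dissipativity constant. -/
theorem mem_opResolventSet_of_dissipative {A : E →ₗ.[ℂ] E} (hA : A.IsClosed) {ω : ℝ}
    (h : ∀ x ∈ A.graph, (inner ℂ x.1 x.2).re ≤ ω * ‖x.1‖ ^ 2) {z : ℂ} (hz : ω < z.re)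
    (hd : Dense {f | ∃ x ∈ A.graph, z • x.1 - x.2 = f}) : z ∈ opResolventSet A := by
  -- The bound controls both components of `x`, so `z - A`, viewed as a bounded operator on the
  -- complete graph, has closed range; density then gives surjectivity.
  have hbound : ∀ x ∈ A.graph, ‖x‖ ≤ (max (z.re - ω)⁻¹ (‖z‖ * (z.re - ω)⁻¹ + 1)) *
      ‖z • x.1 - x.2‖ := by
    intro x hx
    have h1 : ‖x.1‖ ≤ (z.re - ω)⁻¹ * ‖z • x.1 - x.2‖ :=
      (le_inv_mul_iff₀ (sub_pos.2 hz)).2 (norm_le_of_re_inner_le (h x hx) z)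
    rw [Prod.norm_def, max_le_iff]
    refine ⟨h1.trans (by gcongr; exact le_max_left _ _), ?_⟩
    calc ‖x.2‖ = ‖z • x.1 - (z • x.1 - x.2)‖ := by rw [sub_sub_cancel]
      _ ≤ ‖z‖ * ‖x.1‖ + ‖z • x.1 - x.2‖ := (norm_sub_le _ _).trans_eq (by rw [norm_smul])
      _ ≤ ‖z‖ * ((z.re - ω)⁻¹ * ‖z • x.1 - x.2‖) + ‖z • x.1 - x.2‖ := by gcongr
      _ = (‖z‖ * (z.re - ω)⁻¹ + 1) * ‖z • x.1 - x.2‖ := by ring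
      _ ≤ _ := by gcongr; exact le_max_right _ _
  have hcomp : CompleteSpace A.graph := IsClosed.completeSpace_coe (hs := hA)
  set T : A.graph →L[ℂ] E :=
    (z • ContinuousLinearMap.fst ℂ E E - ContinuousLinearMap.snd ℂ E E) ∘L A.graph.subtypeL with hT
  have hTapp : ∀ x : A.graph, T x = z • x.1.1 - x.1.2 := fun x => rfl
  have hanti : AntilipschitzWith (Real.toNNReal (max (z.re - ω)⁻¹ (‖z‖ * (z.re - ω)⁻¹ + 1))) T := by
    refine T.antilipschitz_of_bound fun x => ?_
    rw [Real.coe_toNNReal _ (le_max_of_le_right (by have := sub_pos.2 hz; positivity))]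
    exact hbound x x.2
  have hsurj : Function.Surjective T := by
    have hcl : IsClosed (range T) := hanti.isClosed_range T.uniformContinuous
    rw [← range_eq_univ, ← hcl.closure_eq, ← dense_iff_closure_eq]
    refine hd.mono ?_
    rintro _ ⟨x, hx, rfl⟩
    exact ⟨⟨x, hx⟩, rfl⟩
  set e := ContinuousLinearEquiv.ofBijective T (LinearMap.ker_eq_bot.2 hanti.injective)
    (LinearMap.range_eq_top.2 hsurj)
  have he : ∀ x, e x = T x := fun x => rfl
  refine ⟨ContinuousLinearMap.fst ℂ E E ∘L A.graph.subtypeL ∘L e.symm.toContinuousLinearMap,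
    isResolventAt_iff_graph.2 ⟨fun f => ?_, fun x hx => ?_⟩⟩
  · have h1 : T (e.symm f) = f := e.apply_symm_apply f
    rw [hTapp] at h1
    have h2 : z • (e.symm f).1.1 - f = (e.symm f).1.2 := by
      nth_rw 2 [← h1]
      rw [sub_sub_cancel]
    change ((e.symm f).1.1, z • (e.symm f).1.1 - f) ∈ A.graph
    rw [h2]
    exact (e.symm f).2
  · have h1 : e.symm (z • x.1 - x.2) = ⟨x, hx⟩ := e.symm_apply_apply ⟨x, hx⟩
    change (e.symm (z • x.1 - x.2)).1.1 = x.1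
    rw [h1]

end Dissipative

/-! ### Monomials -/

theorem continuous_monomial (n : ℕ) : Continuous fun ρ : ℝ => (ρ : ℂ) ^ n := by fun_prop

theorem memLp_monomial (n : ℕ) : MemLp (fun ρ : ℝ => (ρ : ℂ) ^ n) 2 unitMeasure :=
  memLp_of_continuousOn (continuous_monomial n).continuousOn

/-- The monomial `ρⁿ` as an element of `L²(0,1)`. -/
noncomputable def monomial (n : ℕ) : L2 := (memLp_monomial n).toLp _

/-- The pair `(ρⁿ, 0)`. -/
noncomputable def fstMonomial (n : ℕ) : H := WithLp.toLp 2 (monomial n, 0)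

/-- The pair `(0, ρⁿ)`. -/
noncomputable def sndMonomial (n : ℕ) : H := WithLp.toLp 2 (0, monomial n)

theorem monomial_ae (n : ℕ) : monomial n =ᵐ[unitMeasure] fun ρ : ℝ => (ρ : ℂ) ^ n :=
  (memLp_monomial n).coeFn_toLp

theorem mem_freeGraph_of_hasDerivAt {v₁ v₂ d₁ d₂ : ℝ → ℂ}
    (h₁ : ∀ ρ ∈ Icc (0 : ℝ) 1, HasDerivAt v₁ (d₁ ρ) ρ) (c₁ : ContinuousOn d₁ (Icc 0 1))
    (h₂ : ∀ ρ ∈ Icc (0 : ℝ) 1, HasDerivAt v₂ (d₂ ρ) ρ) (c₂ : ContinuousOn d₂ (Icc 0 1))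
    (h0 : v₁ 0 = 0) {u w : H} (hu₁ : u.fst =ᵐ[unitMeasure] v₁) (hu₂ : u.snd =ᵐ[unitMeasure] v₂)
    (hw₁ : w.fst =ᵐ[unitMeasure] fun ρ => -(ρ : ℂ) * d₁ ρ + d₂ ρ)
    (hw₂ : w.snd =ᵐ[unitMeasure] fun ρ => d₁ ρ - (ρ : ℂ) * d₂ ρ) : (u, w) ∈ freeGraph := by
  have hD : ∀ {v d : ℝ → ℂ}, (∀ ρ ∈ Icc (0 : ℝ) 1, HasDerivAt v (d ρ) ρ) →
      ∀ ρ ∈ Icc (0 : ℝ) 1, D v ρ = d ρ := fun h ρ hρ =>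
    (h ρ hρ).hasDerivWithinAt.derivWithin (uniqueDiffOn_Icc zero_lt_one ρ hρ)
  have hC : ∀ {v d : ℝ → ℂ}, (∀ ρ ∈ Icc (0 : ℝ) 1, HasDerivAt v (d ρ) ρ) →
      ContinuousOn d (Icc 0 1) → ContDiffOn ℝ 1 v (Icc 0 1) := fun h hc =>
    (contDiffOn_one_iff_derivWithin (uniqueDiffOn_Icc zero_lt_one)).2
      ⟨fun ρ hρ => (h ρ hρ).differentiableAt.differentiableWithinAt, hc.congr (hD h)⟩
  refine ⟨v₁, v₂, ⟨hC h₁ c₁, hC h₂ c₂, h0⟩, hu₁, hu₂, ?_, ?_⟩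
  · filter_upwards [hw₁, ae_restrict_mem measurableSet_Ioo] with ρ e hρ
    rw [e, hD h₁ ρ (Ioo_subset_Icc_self hρ), hD h₂ ρ (Ioo_subset_Icc_self hρ)]
  · filter_upwards [hw₂, ae_restrict_mem measurableSet_Ioo] with ρ e hρ
    rw [e, hD h₁ ρ (Ioo_subset_Icc_self hρ), hD h₂ ρ (Ioo_subset_Icc_self hρ)]

theorem hasDerivAt_monomial (n : ℕ) (ρ : ℝ) :
    HasDerivAt (fun ρ : ℝ => (ρ : ℂ) ^ n) (n * (ρ : ℂ) ^ (n - 1)) ρ :=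
  (hasDerivAt_pow n (ρ : ℂ)).comp_ofReal

/-- The exponent starts at `1`, as the boundary condition at `0` excludes constants in the first
slot. -/
theorem fstMonomial_mem_freeGraph (n : ℕ) :
    (fstMonomial (n + 1), -(n + 1 : ℂ) • fstMonomial (n + 1) + (n + 1 : ℂ) • sndMonomial n) ∈
      freeGraph := by
  refine mem_freeGraph_of_hasDerivAt (fun ρ _ => hasDerivAt_monomial (n + 1) ρ)
    (by fun_prop) (v₂ := fun _ => 0) (d₂ := fun _ => 0) (fun ρ _ => hasDerivAt_const ρ 0)
    continuousOn_const (by simp) (monomial_ae _) (Lp.coeFn_zero _ _ _) ?_ ?_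
  · have e : (-(n + 1 : ℂ) • fstMonomial (n + 1) + (n + 1 : ℂ) • sndMonomial n).fst =
        -(n + 1 : ℂ) • monomial (n + 1) := by
      simp [fstMonomial, sndMonomial]
    rw [e]
    refine (Lp.coeFn_smul _ _).trans ?_
    filter_upwards [monomial_ae (n + 1)] with ρ h
    simp only [Pi.smul_apply, h, smul_eq_mul]
    push_cast
    ring
  · have e : (-(n + 1 : ℂ) • fstMonomial (n + 1) + (n + 1 : ℂ) • sndMonomial n).snd =
        (n + 1 : ℂ) • monomial n := by
      simp [fstMonomial, sndMonomial]
    rw [e]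
    refine (Lp.coeFn_smul _ _).trans ?_
    filter_upwards [monomial_ae n] with ρ h
    simp only [Pi.smul_apply, h, smul_eq_mul]
    push_cast
    ring

/-- At `n = 0` the truncated exponent `n - 1` is harmless, its coefficient being `0`. -/
theorem sndMonomial_mem_freeGraph (n : ℕ) :
    (sndMonomial n, (n : ℂ) • fstMonomial (n - 1) - (n : ℂ) • sndMonomial n) ∈ freeGraph := by
  refine mem_freeGraph_of_hasDerivAt (v₁ := fun _ => 0) (d₁ := fun _ => 0)
    (fun ρ _ => hasDerivAt_const ρ 0) continuousOn_const (fun ρ _ => hasDerivAt_monomial n ρ)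
    (by fun_prop) rfl (Lp.coeFn_zero _ _ _) (monomial_ae _) ?_ ?_
  · have e : ((n : ℂ) • fstMonomial (n - 1) - (n : ℂ) • sndMonomial n).fst =
        (n : ℂ) • monomial (n - 1) := by
      simp [fstMonomial, sndMonomial]
    rw [e]
    refine (Lp.coeFn_smul _ _).trans ?_
    filter_upwards [monomial_ae (n - 1)] with ρ h
    simp [h]
  · have e : ((n : ℂ) • fstMonomial (n - 1) - (n : ℂ) • sndMonomial n).snd =
        -(n : ℂ) • monomial n := by
      simp [fstMonomial, sndMonomial]
    rw [e]
    refine (Lp.coeFn_smul _ _).trans ?_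
    filter_upwards [monomial_ae n] with ρ h
    simp only [Pi.smul_apply, h, smul_eq_mul]
    rcases n with _ | n
    · simp
    · rw [Nat.add_sub_cancel]
      ring

theorem primitiveOp_monomial (n : ℕ) :
    primitiveOp (monomial n) = (1 / (n + 1) : ℂ) • monomial (n + 1) := by
  refine Lp.ext ?_
  have h : primitiveOp (monomial n) =ᵐ[unitMeasure] fun ρ => ∫ ξ in (0 : ℝ)..ρ, monomial n ξ :=
    (memLp_primitive (monomial n)).coeFn_toLp
  filter_upwards [h, Lp.coeFn_smul (1 / (n + 1) : ℂ) (monomial (n + 1)), monomial_ae (n + 1),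
    ae_restrict_mem measurableSet_Ioo] with ρ h1 h2 h3 hρ
  rw [h1, h2, Pi.smul_apply, h3, integral_congr_L2 (monomial_ae n) hρ]
  have := integral_pow (a := 0) (b := ρ) n
  rw [zero_pow n.succ_ne_zero, sub_zero] at this
  have e : ∫ ξ in (0 : ℝ)..ρ, (ξ : ℂ) ^ n = ((∫ ξ in (0 : ℝ)..ρ, ξ ^ n : ℝ) : ℂ) := by
    rw [← intervalIntegral.integral_ofReal]
    simp
  rw [e, this]
  push_cast
  rw [smul_eq_mul]
  ring

theorem pertOp_apply (p : ℕ) (u : H) :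
    pertOp p u = ((p * c₀ p : ℝ) : ℂ) • WithLp.toLp 2 (primitiveOp u.snd, 0) := rfl

theorem pertOp_fstMonomial (p n : ℕ) : pertOp p (fstMonomial n) = 0 := by
  rw [pertOp_apply]
  have : (fstMonomial n).snd = 0 := rfl
  rw [this, map_zero]
  exact smul_zero _

theorem pertOp_sndMonomial (p n : ℕ) :
    pertOp p (sndMonomial n) = (((p * c₀ p : ℝ) : ℂ) / (n + 1)) • fstMonomial (n + 1) := by
  rw [pertOp_apply]
  have : (sndMonomial n).snd = monomial n := rfl
  have e : (WithLp.toLp 2 ((1 / (n + 1) : ℂ) • monomial (n + 1), (0 : L2)) : H) =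
      (1 / (n + 1) : ℂ) • fstMonomial (n + 1) := by
    refine WithLp.ofLp_injective 2 (Prod.ext rfl ?_)
    exact (smul_zero _).symm
  rw [this, primitiveOp_monomial, e, smul_smul]
  congr 1
  ring

/-! ### Density of polynomials -/

theorem ae_eq_zero_of_integral_even_pow {g : ℝ → ℂ} (hg : Integrable g unitMeasure)
    (h : ∀ m : ℕ, ∫ ρ, (ρ : ℂ) ^ (2 * m) * g ρ ∂unitMeasure = 0) : g =ᵐ[unitMeasure] 0 := by
  have hpoly : ∀ q : Polynomial ℝ, ∫ ρ, ((q.eval (ρ ^ 2) : ℝ) : ℂ) * g ρ ∂unitMeasure = 0 := by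
    intro q
    have e : ∀ ρ : ℝ, ((q.eval (ρ ^ 2) : ℝ) : ℂ) * g ρ =
        ∑ i ∈ Finset.range (q.natDegree + 1), (q.coeff i : ℂ) * ((ρ : ℂ) ^ (2 * i) * g ρ) := by
      intro ρ
      rw [Polynomial.eval_eq_sum_range, Complex.ofReal_sum, Finset.sum_mul]
      refine Finset.sum_congr rfl fun i _ => ?_
      push_cast
      rw [pow_mul]
      ring
    simp only [e]
    rw [integral_finsetSum]
    · refine Finset.sum_eq_zero fun i _ => ?_
      rw [integral_const_mul, h, mul_zero]
    · intro i _
      refine (hg.bdd_mul (c := 1) (continuous_monomial (2 * i)).aestronglyMeasurable ?_).const_mul _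
      filter_upwards [ae_restrict_mem measurableSet_Ioo] with ρ hρ
      rw [norm_pow, Complex.norm_real, Real.norm_of_nonneg hρ.1.le]
      exact pow_le_one₀ hρ.1.le hρ.2.le
  have hcont : ∀ k : ℝ → ℝ, Continuous k → ∫ ρ, (k ρ : ℂ) * g ρ ∂unitMeasure = 0 := by
    intro k hk
    rw [← norm_le_zero_iff]
    refine le_of_forall_pos_le_add fun ε hε => ?_
    set M := ∫ ρ, ‖g ρ‖ ∂unitMeasure with hM
    have hM0 : 0 ≤ M := integral_nonneg fun _ => norm_nonneg _
    -- Weierstrass in the variable `s = ρ²`: approximating `k (√s)` makes even powers suffice on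
    -- `(0,1)`. Dividing by `M + 1` covers the case `M = 0`.
    obtain ⟨q, hq⟩ := exists_polynomial_near_of_continuousOn 0 1 (fun s => k √s)
      (by fun_prop) (ε / (M + 1)) (by positivity)
    have hd : ∀ ρ ∈ Ioo (0 : ℝ) 1, ‖((k ρ - q.eval (ρ ^ 2) : ℝ) : ℂ)‖ ≤ ε / (M + 1) := by
      intro ρ hρ
      have := hq (ρ ^ 2) ⟨by positivity, pow_le_one₀ hρ.1.le hρ.2.le⟩
      rw [Real.sqrt_sq hρ.1.le, abs_sub_comm] at this
      rw [Complex.norm_real]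
      exact this.le
    have hint : ∀ k : ℝ → ℝ, Continuous k → Integrable (fun ρ => (k ρ : ℂ) * g ρ) unitMeasure := by
      intro k hk
      obtain ⟨C, hC⟩ := (isCompact_Icc (a := (0 : ℝ)) (b := 1)).exists_bound_of_continuousOn
        hk.continuousOn
      refine hg.bdd_mul (c := C) (Complex.continuous_ofReal.comp hk).aestronglyMeasurable ?_
      filter_upwards [ae_restrict_mem measurableSet_Ioo] with ρ hρ
      rw [Complex.norm_real]
      exact hC ρ (Ioo_subset_Icc_self hρ)
    have e : ∫ ρ, (k ρ : ℂ) * g ρ ∂unitMeasure =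
        ∫ ρ, ((k ρ - q.eval (ρ ^ 2) : ℝ) : ℂ) * g ρ ∂unitMeasure := by
      rw [← sub_zero (∫ ρ, (k ρ : ℂ) * g ρ ∂unitMeasure), ← hpoly q,
        ← integral_sub (hint k hk) (hint _ (by fun_prop))]
      refine integral_congr_ae (Filter.Eventually.of_forall fun ρ => ?_)
      simp only []
      push_cast
      ring
    rw [e, zero_add]
    calc _ ≤ ∫ ρ, ε / (M + 1) * ‖g ρ‖ ∂unitMeasure := by
          refine norm_integral_le_of_norm_le (hg.norm.const_mul _) ?_
          filter_upwards [ae_restrict_mem measurableSet_Ioo] with ρ hρ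
          rw [norm_mul]
          exact mul_le_mul_of_nonneg_right (hd ρ hρ) (norm_nonneg _)
      _ = ε * (M / (M + 1)) := by rw [integral_const_mul]; ring
      _ ≤ ε * 1 := by
          gcongr
          rw [div_le_one (by positivity)]
          linarith
      _ = ε := mul_one ε
  have hg' : IntegrableOn g (Ioo 0 1) volume := hg
  have := isOpen_Ioo.ae_eq_zero_of_integral_contDiff_smul_eq_zero hg'.locallyIntegrableOn
    (fun k hk _ hks => ?_)
  · exact (ae_restrict_iff' measurableSet_Ioo).2 this
  · have e : ∫ x, k x • g x = ∫ x in Ioo (0 : ℝ) 1, k x • g x := by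
      refine (setIntegral_eq_integral_of_forall_compl_eq_zero fun x hx => ?_).symm
      rw [image_eq_zero_of_notMem_tsupport fun h' => hx (hks h'), zero_smul]
    rw [e]
    exact hcont k hk.continuous

theorem dense_of_monomial_mem {S : Submodule ℂ H} (h₁ : ∀ m, fstMonomial (2 * m + 1) ∈ S)
    (h₂ : ∀ m, sndMonomial (2 * m) ∈ S) : Dense (S : Set H) := by
  rw [Submodule.dense_iff_topologicalClosure_eq_top, Submodule.topologicalClosure_eq_top_iff,
    Submodule.eq_bot_iff]
  intro φ hφ
  have hmon : ∀ (n : ℕ) (f : L2), inner ℂ (monomial n) f =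
      ∫ ρ, (ρ : ℂ) ^ n * f ρ ∂unitMeasure := by
    intro n f
    rw [L2.inner_def]
    refine integral_congr_ae ?_
    filter_upwards [monomial_ae n] with ρ hρ
    rw [hρ, RCLike.inner_apply, map_pow, Complex.conj_ofReal, mul_comm]
  have hint : ∀ f : L2, Integrable f unitMeasure := fun f => (Lp.memLp f).integrable one_le_two
  have k1 : ∀ m : ℕ, ∫ ρ, (ρ : ℂ) ^ (2 * m + 1) * φ.fst ρ ∂unitMeasure = 0 := by
    intro m
    have := hφ _ (h₁ m)
    rw [WithLp.prod_inner_apply] at this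
    change inner ℂ (monomial _) φ.fst + inner ℂ (0 : L2) φ.snd = 0 at this
    rwa [inner_zero_left, add_zero, hmon] at this
  have k2 : ∀ m : ℕ, ∫ ρ, (ρ : ℂ) ^ (2 * m) * φ.snd ρ ∂unitMeasure = 0 := by
    intro m
    have := hφ _ (h₂ m)
    rw [WithLp.prod_inner_apply] at this
    change inner ℂ (0 : L2) φ.fst + inner ℂ (monomial _) φ.snd = 0 at this
    rwa [inner_zero_left, zero_add, hmon] at this
  have z2 := ae_eq_zero_of_integral_even_pow (hint φ.snd) k2
  -- Odd moments of `φ.fst` are even moments of `ρ φ.fst`, and the factor `ρ` is nonzero on `(0,1)`.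
  have z1 : (fun ρ : ℝ => (ρ : ℂ) * φ.fst ρ) =ᵐ[unitMeasure] 0 := by
    refine ae_eq_zero_of_integral_even_pow ((hint φ.fst).bdd_mul (c := 1)
      Complex.continuous_ofReal.aestronglyMeasurable ?_) fun m => ?_
    · filter_upwards [ae_restrict_mem measurableSet_Ioo] with ρ hρ
      rw [Complex.norm_real, Real.norm_of_nonneg hρ.1.le]
      exact hρ.2.le
    · rw [← k1 m]
      refine integral_congr_ae (Filter.Eventually.of_forall fun ρ => ?_)
      simp only [pow_succ]
      ring
  refine H_ext ?_ ?_
  · refine Filter.EventuallyEq.trans ?_ (Lp.coeFn_zero ℂ 2 unitMeasure).symm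
    filter_upwards [z1, ae_restrict_mem measurableSet_Ioo] with ρ h hρ
    exact (mul_eq_zero.1 h).resolve_left (Complex.ofReal_ne_zero.2 hρ.1.ne')
  · exact z2.trans (Lp.coeFn_zero ℂ 2 unitMeasure).symm

/-- If `A` acts on odd/even monomials as `L₀ + L'` does, with coupling constant `c`, then `z - A`
has dense range unless `(z + n) (z + n - 1) = c` for some odd `n`. -/
theorem dense_range_of_monomial_mem {A : H →ₗ.[ℂ] H} {c : ℂ}
    (h₁ : ∀ n, (fstMonomial (n + 1),
      -(n + 1 : ℂ) • fstMonomial (n + 1) + (n + 1 : ℂ) • sndMonomial n) ∈ A.graph)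
    (h₂ : ∀ n : ℕ, (sndMonomial n, (n : ℂ) • fstMonomial (n - 1) - (n : ℂ) • sndMonomial n +
      (c / (n + 1)) • fstMonomial (n + 1)) ∈ A.graph) {z : ℂ}
    (hz : ∀ m : ℕ, (z + (2 * m + 1)) * (z + 2 * m) ≠ c) :
    Dense {f | ∃ x ∈ A.graph, z • x.1 - x.2 = f} := by
  set S : Submodule ℂ H := A.graph.map (z • LinearMap.fst ℂ H H - LinearMap.snd ℂ H H) with hS
  have hSS : {f | ∃ x ∈ A.graph, z • x.1 - x.2 = f} = (S : Set H) := by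
    ext f
    simp [hS]
  rw [hSS]
  have hmem : ∀ x ∈ A.graph, z • x.1 - x.2 ∈ S := fun x hx => ⟨x, hx, by simp⟩
  -- Modulo the lower term `n ρ^(n-1)` of the first slot, the images of the two monomials form a 2×2
  -- system in them; the combinations below are Cramer's rule. The lower term is supplied by the
  -- block two degrees down, and is absent for `n = 0`.
  have step : ∀ n : ℕ, (z + (n + 1)) * (z + n) ≠ c → (n : ℂ) • fstMonomial (n - 1) ∈ S →
      fstMonomial (n + 1) ∈ S ∧ sndMonomial n ∈ S := by
    intro n hn hF
    have hn1 : (n + 1 : ℂ) ≠ 0 := Nat.cast_add_one_ne_zero n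
    have hΔ := sub_ne_zero.2 hn
    have hP := hmem _ (h₁ n)
    have hQ := S.add_mem (hmem _ (h₂ n)) hF
    refine ⟨(S.smul_mem_iff hΔ).1 ?_, (S.smul_mem_iff hΔ).1 ?_⟩
    · convert S.add_mem (S.smul_mem (z + n) hP) (S.smul_mem (n + 1 : ℂ) hQ) using 1
      match_scalars <;> field_simp <;> ring
    · convert S.add_mem (S.smul_mem (c / (n + 1)) hP) (S.smul_mem (z + (n + 1)) hQ) using 1
      match_scalars <;> field_simp <;> ring
  have key : ∀ m : ℕ, fstMonomial (2 * m + 1) ∈ S ∧ sndMonomial (2 * m) ∈ S := by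
    intro m
    have hm : (z + ((2 * m : ℕ) + 1)) * (z + (2 * m : ℕ)) ≠ c := by
      have := hz m
      push_cast
      exact this
    induction m with
    | zero => exact step _ hm (by simp)
    | succ m ih =>
      refine step _ hm (S.smul_mem _ (ih ?_).1)
      have := hz m
      push_cast
      exact this
  exact dense_of_monomial_mem (fun m => (key m).1) fun m => (key m).2


/-! ### The free operator and its right half-plane of resolvent points -/

theorem dense_freeCore_domain : Dense (freeCore.domain : Set H) := by
  refine dense_of_monomial_mem (fun m => ?_) fun m => ?_
  · exact LinearPMap.mem_domain_of_mem_graph (freeCore_graph ▸ fstMonomial_mem_freeGraph (2 * m))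
  · exact LinearPMap.mem_domain_of_mem_graph (freeCore_graph ▸ sndMonomial_mem_freeGraph (2 * m))

theorem isClosable_freeCore : freeCore.IsClosable :=
  isClosable_of_dissipative dense_freeCore_domain fun _ hx =>
    re_inner_freeGraph_le (freeCore_graph ▸ hx)

theorem freeOp_graph : freeOp.graph = freeGraph.topologicalClosure := by
  rw [freeOp, ← isClosable_freeCore.graph_closure_eq_closure_graph, freeCore_graph]

theorem mem_freeOp_graph {x : H × H} (hx : x ∈ freeGraph) : x ∈ freeOp.graph :=
  freeOp_graph ▸ freeGraph.le_topologicalClosure hx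

theorem dense_range_sub_freeOp {z : ℂ} (hz : ∀ m : ℕ, (z + (2 * m + 1)) * (z + 2 * m) ≠ 0) :
    Dense {f | ∃ x ∈ freeOp.graph, z • x.1 - x.2 = f} := by
  refine dense_range_of_monomial_mem (fun n => mem_freeOp_graph (fstMonomial_mem_freeGraph n))
    (fun n => ?_) hz
  rw [zero_div, zero_smul, add_zero]
  exact mem_freeOp_graph (sndMonomial_mem_freeGraph n)

theorem dense_range_sub_fullOp {p : ℕ} {z : ℂ}
    (hz : ∀ m : ℕ, (z + (2 * m + 1)) * (z + 2 * m) ≠ ((p * c₀ p : ℝ) : ℂ)) :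
    Dense {f | ∃ x ∈ (fullOp p).graph, z • x.1 - x.2 = f} := by
  refine dense_range_of_monomial_mem (fun n => mem_graph_vadd.2 ?_)
    (fun n => mem_graph_vadd.2 ?_) hz
  · rw [pertOp_fstMonomial, sub_zero]
    exact mem_freeOp_graph (fstMonomial_mem_freeGraph n)
  · rw [pertOp_sndMonomial, add_sub_cancel_right]
    exact mem_freeOp_graph (sndMonomial_mem_freeGraph n)

theorem mem_opResolventSet_freeOp {z : ℂ} (hz : 1 / 2 < z.re) : z ∈ opResolventSet freeOp := by
  refine mem_opResolventSet_of_dissipative isClosable_freeCore.closure_isClosed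
    (fun x hx => re_inner_le_of_mem_closure (fun _ => re_inner_freeGraph_le) (freeOp_graph ▸ hx)) hz
    (dense_range_sub_freeOp fun m => mul_ne_zero ?_ ?_)
  all_goals
    intro h
    have := congrArg Complex.re h
    simp at this
    have hm : (0 : ℝ) ≤ m := m.cast_nonneg
    linarith

/-! ### Approximate eigenvectors in the left half-plane -/

/-- Write `ε = ε^δ ε^(1-δ)` and absorb the second factor into a power of `q`: the residual of the
approximate eigenvectors becomes a vanishing factor `ε^δ` times a majorant that will be square
integrable. -/
theorem mul_rpow_le {σ τ δ ε q : ℝ} (hε : 0 < ε) (hq : ε ≤ q) (hq3 : q ≤ 3) (hδ : δ ≤ 1)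
    (hδτ : σ + δ ≤ τ) : ε * q ^ (-σ - 1) ≤ 3 ^ (τ - σ - δ) * ε ^ δ * q ^ (-τ) := by
  have hq0 : 0 < q := hε.trans_le hq
  calc ε * q ^ (-σ - 1) = ε ^ δ * ε ^ (1 - δ) * q ^ (-σ - 1) := by
        rw [← Real.rpow_add hε, add_sub_cancel, Real.rpow_one]
    _ ≤ ε ^ δ * q ^ (1 - δ) * q ^ (-σ - 1) := by
        have := Real.rpow_le_rpow hε.le hq (sub_nonneg.2 hδ)
        gcongr
    _ = ε ^ δ * q ^ (τ - σ - δ) * q ^ (-τ) := by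
        rw [mul_assoc, mul_assoc, ← Real.rpow_add hq0, ← Real.rpow_add hq0]
        congr 2
        ring
    _ ≤ ε ^ δ * 3 ^ (τ - σ - δ) * q ^ (-τ) := by
        have := Real.rpow_le_rpow hq0.le hq3 (by linarith : 0 ≤ τ - σ - δ)
        gcongr
    _ = _ := by ring

theorem memLp_rpow {τ : ℝ} (hτ : τ < 1 / 2) :
    MemLp (fun ρ : ℝ => (((1 - ρ) ^ (-τ) : ℝ) : ℂ)) 2 unitMeasure := by
  have hm : AEStronglyMeasurable (fun ρ : ℝ => (((1 - ρ) ^ (-τ) : ℝ) : ℂ)) unitMeasure := by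
    refine Measurable.aestronglyMeasurable ?_
    fun_prop
  rw [memLp_two_iff_integrable_sq_norm hm]
  have h1 : IntervalIntegrable (fun x : ℝ => x ^ (-2 * τ)) volume 0 1 :=
    intervalIntegral.intervalIntegrable_rpow' (by linarith)
  have h2 := (h1.comp_sub_left 1).symm
  rw [sub_zero, sub_self, intervalIntegrable_iff_integrableOn_Ioo_of_le zero_le_one] at h2
  refine Integrable.congr h2 ?_
  filter_upwards [ae_restrict_mem measurableSet_Ioo] with ρ hρ
  have h0 : 0 ≤ 1 - ρ := sub_nonneg.2 hρ.2.le
  rw [Complex.norm_real, Real.norm_of_nonneg (Real.rpow_nonneg h0 _), ← Real.rpow_natCast,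
    ← Real.rpow_mul h0]
  congr 1
  push_cast
  ring

/-- The odd and even parts of a function on `[-1,1]`, as an element of the domain of `L̃₀`. -/
theorem exists_mem_freeGraph_of_hasDerivAt {W W' : ℝ → ℂ}
    (hW : ∀ s ∈ Icc (-1 : ℝ) 1, HasDerivAt W (W' s) s) (hc : ContinuousOn W' (Icc (-1) 1)) :
    ∃ x ∈ freeGraph, x.1.fst =ᵐ[unitMeasure] (fun ρ => (W ρ - W (-ρ)) / 2) ∧
      x.1.snd =ᵐ[unitMeasure] (fun ρ => (W ρ + W (-ρ)) / 2) ∧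
      x.2.fst =ᵐ[unitMeasure] (fun ρ => ((1 - ρ) * W' ρ - (1 + ρ) * W' (-ρ)) / 2) ∧
      x.2.snd =ᵐ[unitMeasure] (fun ρ => ((1 - ρ) * W' ρ + (1 + ρ) * W' (-ρ)) / 2) := by
  have hm : MapsTo (fun ρ : ℝ => ρ) (Icc 0 1) (Icc (-1) 1) := fun ρ hρ => ⟨by linarith [hρ.1], hρ.2⟩
  have hm' : MapsTo (fun ρ : ℝ => -ρ) (Icc 0 1) (Icc (-1) 1) := fun ρ hρ =>
    ⟨by linarith [hρ.2], by linarith [hρ.1]⟩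
  have hneg : ∀ ρ ∈ Icc (0 : ℝ) 1, HasDerivAt (fun ρ => W (-ρ)) (-W' (-ρ)) ρ := by
    intro ρ hρ
    have := (hW _ (hm' hρ)).scomp ρ (hasDerivAt_neg ρ)
    rw [neg_smul, one_smul] at this
    exact this
  have hWc : ContinuousOn W (Icc (-1) 1) := fun s hs => (hW s hs).continuousAt.continuousWithinAt
  have w1 : ContinuousOn (fun ρ => W ρ) (Icc 0 1) := hWc.comp continuousOn_id hm
  have w2 : ContinuousOn (fun ρ => W (-ρ)) (Icc 0 1) := hWc.comp continuousOn_neg hm'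
  have c1 : ContinuousOn (fun ρ => W' ρ) (Icc 0 1) := hc.comp continuousOn_id hm
  have c2 : ContinuousOn (fun ρ => W' (-ρ)) (Icc 0 1) := hc.comp continuousOn_neg hm'
  have hid : ContinuousOn (fun ρ : ℝ => (ρ : ℂ)) (Icc 0 1) :=
    Complex.continuous_ofReal.continuousOn
  refine ⟨(pairH (f := fun ρ => (W ρ - W (-ρ)) / 2) (g := fun ρ => (W ρ + W (-ρ)) / 2)
      (memLp_of_continuousOn (by fun_prop)) (memLp_of_continuousOn (by fun_prop)),
    pairH (f := fun ρ => ((1 - ρ) * W' ρ - (1 + ρ) * W' (-ρ)) / 2)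
      (g := fun ρ => ((1 - ρ) * W' ρ + (1 + ρ) * W' (-ρ)) / 2)
      (memLp_of_continuousOn (by fun_prop)) (memLp_of_continuousOn (by fun_prop))),
    mem_freeGraph_of_hasDerivAt (d₁ := fun ρ => (W' ρ + W' (-ρ)) / 2)
      (d₂ := fun ρ => (W' ρ - W' (-ρ)) / 2) (fun ρ hρ => ?_) (by fun_prop) (fun ρ hρ => ?_)
      (by fun_prop) (by simp) (pairH_fst _ _) (pairH_snd _ _) ((pairH_fst _ _).trans ?_)
      ((pairH_snd _ _).trans ?_),
    pairH_fst _ _, pairH_snd _ _, pairH_fst _ _, pairH_snd _ _⟩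
  · exact (((hW ρ (hm hρ)).sub (hneg ρ hρ)).div_const 2).congr_deriv (by ring)
  · exact (((hW ρ (hm hρ)).add (hneg ρ hρ)).div_const 2).congr_deriv (by ring)
  · exact Filter.Eventually.of_forall fun ρ => by ring
  · exact Filter.Eventually.of_forall fun ρ => by ring

theorem monomial_zero_ne_zero : monomial 0 ≠ 0 := by
  intro h0
  have h1 := monomial_ae 0
  rw [h0] at h1
  have h2 : ∀ᵐ ρ ∂unitMeasure, False := by
    filter_upwards [h1, Lp.coeFn_zero ℂ 2 unitMeasure] with ρ e1 e2
    rw [e2] at e1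
    simp at e1
  rw [Filter.eventually_false_iff_eq_bot, ae_eq_bot] at h2
  have := congrArg (fun μ : Measure ℝ => μ univ) h2
  simp at this

/-- With `W(s) = (1 + ε - s)^(-z)` the residual `z W - (1 - s) W'` is `ε W'`. It tends to `0` in
`L²` exactly because an exponent `τ` fits between `Re z` and `1/2`. -/
theorem exists_approx_eigenvector {z : ℂ} (hz : z.re < 1 / 2) :
    ∃ m > 0, ∀ η > 0, ∃ x ∈ freeGraph, m ≤ ‖x.1‖ ∧ ‖z • x.1 - x.2‖ ≤ η := by
  set σ := z.re with hσ
  -- `τ < 1/2` puts `(1 - ρ)^(-τ)` in `L²`; `τ > 0` makes it dominate `(1 + ε - s)^(-τ)` for all `s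
  -- ≤ ρ`.
  obtain ⟨τ, hτ1, hτ2, hτ0⟩ : ∃ τ, σ < τ ∧ τ < 1 / 2 ∧ 0 < τ :=
    ⟨max (1 / 4) ((σ + 1 / 2) / 2), lt_max_of_lt_right (by linarith),
      max_lt (by norm_num) (by linarith), lt_max_of_lt_left (by norm_num)⟩
  obtain ⟨δ, hδ1, hδ2, hδ0⟩ : ∃ δ, δ ≤ 1 ∧ σ + δ ≤ τ ∧ 0 < δ :=
    ⟨min 1 (τ - σ), min_le_left _ _, by linarith [min_le_right 1 (τ - σ)],
      lt_min one_pos (sub_pos.2 hτ1)⟩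
  set h : L2 := (memLp_rpow hτ2).toLp _ with hh
  have h_ae : h =ᵐ[unitMeasure] fun ρ : ℝ => (((1 - ρ) ^ (-τ) : ℝ) : ℂ) :=
    (memLp_rpow hτ2).coeFn_toLp
  -- A lower bound, uniform in `ε ≤ 1`, for `|W(-ρ)|`, whose base lies in `[1, 3]` away from the
  -- singularity. Since `u₂ - u₁ = W(-ρ)`, the norms stay bounded below.
  set m : ℝ := min 1 (3 ^ (-σ)) with hm
  have hm0 : 0 < m := lt_min one_pos (by positivity)
  have hone : 0 < ‖monomial 0‖ := norm_pos_iff.2 monomial_zero_ne_zero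
  refine ⟨m * ‖monomial 0‖ / 2, by positivity, fun η hη => ?_⟩
  set K : ℝ := ‖z‖ * 3 ^ (τ - σ - δ) with hK
  obtain ⟨ε, hε0, hε1, hε2⟩ : ∃ ε : ℝ, 0 < ε ∧ ε ≤ 1 ∧ 2 * (K * ε ^ δ * ‖h‖) ≤ η := by
    have h1 : Filter.Tendsto (fun ε : ℝ => 2 * (K * ε ^ δ * ‖h‖)) (nhdsWithin 0 (Ioi 0))
        (nhds (2 * (K * 0 ^ δ * ‖h‖))) := by
      have := (Real.continuous_rpow_const hδ0.le).tendsto 0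
      exact (((this.const_mul K).mul_const ‖h‖).const_mul 2).mono_left nhdsWithin_le_nhds
    rw [Real.zero_rpow hδ0.ne', mul_zero, zero_mul, mul_zero] at h1
    obtain ⟨ε, e1, e2, e3⟩ := ((h1.eventually (eventually_le_nhds hη)).and
      ((eventually_mem_nhdsWithin).and
        (nhdsWithin_le_nhds (eventually_le_nhds (zero_lt_one (α := ℝ)))))).exists
    exact ⟨ε, e2, e3, e1⟩
  set W : ℝ → ℂ := fun s => (1 + ε - s : ℂ) ^ (-z) with hW
  set W' : ℝ → ℂ := fun s => z * (1 + ε - s : ℂ) ^ (-z - 1) with hW'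
  have hcast : ∀ s : ℝ, (1 + ε - s : ℂ) = ((1 + ε - s : ℝ) : ℂ) := fun s => by push_cast; rfl
  have hslit : ∀ s ∈ Icc (-1 : ℝ) 1, (1 + ε - s : ℂ) ∈ Complex.slitPlane := by
    intro s hs
    rw [hcast, Complex.ofReal_mem_slitPlane]
    linarith [hs.2]
  have hder : ∀ s ∈ Icc (-1 : ℝ) 1, HasDerivAt W (W' s) s := by
    intro s hs
    have h1 : HasDerivAt (fun ζ : ℂ => 1 + ε - ζ) (-1) (s : ℂ) :=
      (hasDerivAt_id (s : ℂ)).const_sub _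
    exact ((h1.cpow_const (c := -z) (hslit s hs)).comp_ofReal).congr_deriv (by simp [hW'])
  have hcont : ContinuousOn W' (Icc (-1) 1) := by
    have h1 : ContinuousOn (fun s : ℝ => (1 + ε - s : ℂ)) (Icc (-1) 1) := by fun_prop
    exact continuousOn_const.mul (h1.cpow continuousOn_const hslit)
  have hnorm : ∀ s < (1 : ℝ), ∀ w : ℂ, ‖(1 + ε - s : ℂ) ^ w‖ = (1 + ε - s) ^ w.re := by
    intro s hs w
    rw [hcast, Complex.norm_cpow_eq_rpow_re_of_pos (by linarith)]
  have hres : ∀ s < (1 : ℝ), z * W s - (1 - s) * W' s = ε * W' s := by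
    intro s hs
    have hne : (1 + ε - s : ℂ) ≠ 0 := by
      rw [hcast, Complex.ofReal_ne_zero]
      linarith
    have e : W s = (1 + ε - s : ℂ) ^ (-z - 1) * (1 + ε - s) := by
      have := Complex.cpow_add (-z - 1) 1 hne
      rwa [sub_add_cancel, Complex.cpow_one] at this
    rw [e, hW']
    ring
  have hbound : ∀ ρ ∈ Ioo (0 : ℝ) 1, ∀ s, -1 ≤ s → s ≤ ρ →
      ‖(ε : ℂ) * W' s‖ ≤ K * ε ^ δ * (1 - ρ) ^ (-τ) := by
    intro ρ hρ s hs1 hs2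
    have h1 := mul_rpow_le (σ := σ) (τ := τ) hε0 (q := 1 + ε - s) (by linarith [hρ.2])
      (by linarith) hδ1 hδ2
    have h2 : (1 + ε - s) ^ (-τ) ≤ (1 - ρ) ^ (-τ) :=
      Real.rpow_le_rpow_of_nonpos (by linarith [hρ.2]) (by linarith) (by linarith)
    rw [hW', norm_mul, norm_mul, hnorm s (by linarith [hρ.2]), Complex.norm_real,
      Real.norm_of_nonneg hε0.le]
    have e : (-z - 1).re = -σ - 1 := by simp [hσ]
    rw [e]
    calc ε * (‖z‖ * (1 + ε - s) ^ (-σ - 1)) = ‖z‖ * (ε * (1 + ε - s) ^ (-σ - 1)) := by ring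
      _ ≤ ‖z‖ * (3 ^ (τ - σ - δ) * ε ^ δ * (1 - ρ) ^ (-τ)) := by
        exact mul_le_mul_of_nonneg_left (h1.trans (by gcongr)) (norm_nonneg z)
      _ = _ := by rw [hK]; ring
  obtain ⟨x, hx, x1, x2, x3, x4⟩ := exists_mem_freeGraph_of_hasDerivAt hder hcont
  refine ⟨x, hx, ?_, ?_⟩
  · have h1 : ‖monomial 0‖ ≤ m⁻¹ * ‖x.1.snd - x.1.fst‖ := by
      refine Lp.norm_le_mul_norm_of_ae_le_mul ?_
      filter_upwards [monomial_ae 0, Lp.coeFn_sub x.1.snd x.1.fst, x1, x2,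
        ae_restrict_mem measurableSet_Ioo] with ρ e0 e1 e2 e3 hρ
      rw [e0, e1, Pi.sub_apply, e2, e3, pow_zero, norm_one]
      have e : (W ρ + W (-ρ)) / 2 - (W ρ - W (-ρ)) / 2 = W (-ρ) := by ring
      rw [e, hW, hnorm _ (by linarith [hρ.1]), le_inv_mul_iff₀ hm0, mul_one, Complex.neg_re, ← hσ]
      have hq1 : 1 ≤ 1 + ε - -ρ := by linarith [hρ.1]
      have hq3 : 1 + ε - -ρ ≤ 3 := by linarith [hρ.2]
      rcases le_total 0 (-σ) with hs | hs
      · exact (min_le_left _ _).trans (Real.one_le_rpow hq1 hs)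
      · exact (min_le_right _ _).trans (Real.rpow_le_rpow_of_nonpos (by linarith) hq3 hs)
    have h2 : ‖x.1.snd - x.1.fst‖ ≤ 2 * ‖x.1‖ := by
      have := norm_sub_le x.1.snd x.1.fst
      have a1 := WithLp.norm_fst_le _ x.1
      have a2 := WithLp.norm_snd_le _ x.1
      linarith
    rw [le_inv_mul_iff₀ hm0] at h1
    linarith
  · have hbd : ∀ ρ ∈ Ioo (0 : ℝ) 1, ∀ c d : ℂ, ‖c‖ ≤ K * ε ^ δ * (1 - ρ) ^ (-τ) →
        ‖d‖ ≤ K * ε ^ δ * (1 - ρ) ^ (-τ) → h ρ = (((1 - ρ) ^ (-τ) : ℝ) : ℂ) →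
        ‖(c + d) / 2‖ ≤ K * ε ^ δ * ‖h ρ‖ := by
      intro ρ hρ c d hc hd e
      rw [e, Complex.norm_real, Real.norm_of_nonneg
        (Real.rpow_nonneg (sub_nonneg.2 hρ.2.le) _), norm_div, RCLike.norm_ofNat]
      linarith [norm_add_le c d]
    have n1 : ‖(z • x.1 - x.2).fst‖ ≤ K * ε ^ δ * ‖h‖ := by
      refine Lp.norm_le_mul_norm_of_ae_le_mul ?_
      filter_upwards [Lp.coeFn_sub (z • x.1.fst) x.2.fst, Lp.coeFn_smul z x.1.fst, x1, x3, h_ae,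
        ae_restrict_mem measurableSet_Ioo] with ρ e0 e1 e2 e3 e4 hρ
      have e : (z • x.1 - x.2).fst ρ = (ε * W' ρ + -(ε * W' (-ρ))) / 2 := by
        change (z • x.1.fst - x.2.fst : L2) ρ = _
        rw [e0, Pi.sub_apply, e1, Pi.smul_apply, e2, e3, ← hres ρ hρ.2,
          ← hres (-ρ) (by linarith [hρ.1]), smul_eq_mul]
        push_cast
        ring
      rw [e]
      refine hbd ρ hρ _ _ (hbound ρ hρ ρ (by linarith [hρ.1]) le_rfl) ?_ e4
      rw [norm_neg]
      exact hbound ρ hρ (-ρ) (by linarith [hρ.2]) (by linarith [hρ.1])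
    have n2 : ‖(z • x.1 - x.2).snd‖ ≤ K * ε ^ δ * ‖h‖ := by
      refine Lp.norm_le_mul_norm_of_ae_le_mul ?_
      filter_upwards [Lp.coeFn_sub (z • x.1.snd) x.2.snd, Lp.coeFn_smul z x.1.snd, x2, x4, h_ae,
        ae_restrict_mem measurableSet_Ioo] with ρ e0 e1 e2 e3 e4 hρ
      have e : (z • x.1 - x.2).snd ρ = (ε * W' ρ + ε * W' (-ρ)) / 2 := by
        change (z • x.1.snd - x.2.snd : L2) ρ = _
        rw [e0, Pi.sub_apply, e1, Pi.smul_apply, e2, e3, ← hres ρ hρ.2,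
          ← hres (-ρ) (by linarith [hρ.1]), smul_eq_mul]
        push_cast
        ring
      rw [e]
      exact hbd ρ hρ _ _ (hbound ρ hρ ρ (by linarith [hρ.1]) le_rfl)
        (hbound ρ hρ (-ρ) (by linarith [hρ.2]) (by linarith [hρ.1])) e4
    linarith [H_norm_le (z • x.1 - x.2)]

theorem notMem_opResolventSet_freeOp {z : ℂ} (hz : z.re < 1 / 2) : z ∉ opResolventSet freeOp := by
  rintro ⟨R, hR⟩
  obtain ⟨m, hm, h⟩ := exists_approx_eigenvector hz
  obtain ⟨x, hx, h1, h2⟩ := h (m / (2 * (‖R‖ + 1))) (by positivity)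
  have h3 := (isResolventAt_iff_graph.1 hR).2 x (mem_freeOp_graph hx)
  have h4 : ‖x.1‖ ≤ ‖R‖ * (m / (2 * (‖R‖ + 1))) := by
    rw [← h3]
    exact (R.le_opNorm _).trans (by gcongr)
  have h5 : ‖R‖ * (m / (2 * (‖R‖ + 1))) < m := by
    rw [mul_div_assoc', div_lt_iff₀ (by positivity)]
    nlinarith [norm_nonneg R]
  linarith

/-! ### The spectrum of the full operator -/

theorem neg_vadd_fullOp (p : ℕ) : ((-pertOp p : H →L[ℂ] H) : H →ₗ[ℂ] H) +ᵥ fullOp p = freeOp :=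
  neg_vadd_vadd (pertOp p : H →ₗ[ℂ] H) freeOp

/-- By openness a resolvent point can be moved off the critical line and off the real axis, where
the determinants of the unperturbed blocks cannot vanish. -/
theorem exists_opResolventSet_near {A : H →ₗ.[ℂ] H} {z : ℂ} (hz : z ∈ opResolventSet A)
    (hre : z.re ≤ 1 / 2) : ∃ w ∈ opResolventSet A, w.re < 1 / 2 ∧ w.im ≠ 0 := by
  obtain ⟨s, hs⟩ : ∃ s : ℝ, ∀ t > 0, z.im + t * s ≠ 0 := by
    rcases le_total 0 z.im with h | h
    · exact ⟨1, fun t ht => by linarith⟩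
    · exact ⟨-1, fun t ht => by linarith⟩
  have hc : Filter.Tendsto (fun t : ℝ => z + t * (-1 + s * Complex.I)) (nhdsWithin 0 (Ioi 0))
      (nhds z) := by
    have : Continuous fun t : ℝ => z + t * (-1 + s * Complex.I) := by fun_prop
    have h := this.tendsto 0
    simp only [Complex.ofReal_zero, zero_mul, add_zero] at h
    exact h.mono_left nhdsWithin_le_nhds
  obtain ⟨t, ht1, ht2⟩ := ((hc.eventually ((isOpen_opResolventSet A).mem_nhds hz)).and
    eventually_mem_nhdsWithin).exists
  have ht2' : 0 < t := ht2
  refine ⟨_, ht1, ?_, ?_⟩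
  · simp
    linarith
  · simpa using hs t ht2

/-- The roles are reversed: `L₀ = L - L'` is a compact perturbation of `L`, so a resolvent point of
`L` left of the line would produce one of `L₀`. -/
theorem re_gt_of_mem_opResolventSet_fullOp {p : ℕ} {z : ℂ} (hz : z ∈ opResolventSet (fullOp p)) :
    1 / 2 < z.re := by
  by_contra! hre
  obtain ⟨w, hw, hw1, hw2⟩ := exists_opResolventSet_near hz hre
  refine notMem_opResolventSet_freeOp hw1 ?_
  rw [← neg_vadd_fullOp p]
  refine mem_opResolventSet_vadd_of_dense (isCompactOperator_pertOp p).neg hw ?_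
  rw [neg_vadd_fullOp p]
  refine dense_range_sub_freeOp fun m => mul_ne_zero ?_ ?_
  all_goals
    intro h
    have := congrArg Complex.im h
    simp at this
    exact hw2 this

theorem mem_opResolventSet_freeOp_iff {z : ℂ} : z ∈ opResolventSet freeOp ↔ 1 / 2 < z.re := by
  refine ⟨fun hz => ?_, mem_opResolventSet_freeOp⟩
  by_contra! hre
  obtain ⟨w, hw, hw1, -⟩ := exists_opResolventSet_near hz hre
  exact notMem_opResolventSet_freeOp hw1 hw

/-- With `κ = 2/(p-1)` the coupling is a product of consecutive terms, so the determinants vanish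
only at `z + 2m = 1 + κ` or `z + 2m = -(2 + κ)`. -/
theorem coupling_eq {p : ℕ} (hp : 1 < p) : ((p * c₀ p : ℝ) : ℂ) =
    (2 / ((p : ℂ) - 1) + 1) * (2 / ((p : ℂ) - 1) + 2) := by
  have h : (p : ℂ) - 1 ≠ 0 := sub_ne_zero.2 (by exact_mod_cast hp.ne')
  rw [c₀]
  push_cast
  field_simp
  ring

theorem mem_opResolventSet_fullOp {p : ℕ} (hp : 3 ≤ p) {z : ℂ} (hz : 1 / 2 < z.re)
    (hne : z ≠ 1 + 2 / ((p : ℂ) - 1)) : z ∈ opResolventSet (fullOp p) := by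
  refine mem_opResolventSet_vadd_of_dense (isCompactOperator_pertOp p)
    (mem_opResolventSet_freeOp hz) (dense_range_sub_fullOp fun m h => ?_)
  -- `κ ≤ 1`, which is where `p ≥ 3` enters, pushes the roots `1 + κ - 2m` with `m ≥ 1` into `Re z ≤
  -- 0`; `κ ≥ 0` does the same for the other family.
  obtain ⟨κ, hκ, hκ0, hκ1⟩ : ∃ κ : ℝ, 2 / ((p : ℂ) - 1) = κ ∧ 0 ≤ κ ∧ κ ≤ 1 := by
    have hp' : (3 : ℝ) ≤ p := by exact_mod_cast hp
    refine ⟨2 / ((p : ℝ) - 1), by push_cast; rfl, div_nonneg zero_le_two (by linarith), ?_⟩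
    rw [div_le_one (by linarith)]
    linarith
  rw [coupling_eq (by omega), hκ] at h
  rw [hκ] at hne
  have hfac : (z + 2 * m - (1 + κ)) * (z + 2 * m + (κ + 2)) = 0 := by linear_combination h
  have hm : (0 : ℝ) ≤ m := m.cast_nonneg
  rcases mul_eq_zero.1 hfac with h' | h'
  · rcases Nat.eq_zero_or_pos m with rfl | hm1
    · refine hne ?_
      simpa [sub_eq_zero] using h'
    · have := congrArg Complex.re h'
      simp at this
      have hm1' : (1 : ℝ) ≤ m := by exact_mod_cast hm1
      linarith
  · have := congrArg Complex.re h'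
    simp at this
    linarith

theorem mem_opPointSpectrum_fullOp {p : ℕ} (hp : 1 < p) :
    1 + 2 / ((p : ℂ) - 1) ∈ opPointSpectrum (fullOp p) := by
  set κ := 2 / ((p : ℂ) - 1) with hκ
  -- The eigenvector `((1 + κ) ρ, 1)` spans the kernel of the singular `m = 0` block.
  have hg : ((1 + κ) • fstMonomial 1 + sndMonomial 0,
      (1 + κ) • ((1 + κ) • fstMonomial 1 + sndMonomial 0)) ∈ (fullOp p).graph := by
    refine mem_graph_vadd.2 ?_
    have h := freeOp.graph.add_mem (freeOp.graph.smul_mem (1 + κ)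
      (mem_freeOp_graph (fstMonomial_mem_freeGraph 0)))
      (mem_freeOp_graph (sndMonomial_mem_freeGraph 0))
    convert h using 1
    refine Prod.ext rfl ?_
    simp only [map_add, map_smul, pertOp_fstMonomial, pertOp_sndMonomial, coupling_eq hp, ← hκ,
      Prod.smul_mk, Prod.mk_add_mk]
    match_scalars <;> ring
  obtain ⟨u, hu, hu'⟩ := (LinearPMap.mem_graph_iff _).1 hg
  refine ⟨u, ?_, ?_⟩
  · rw [hu]
    intro h0
    have h1 : ((1 + κ) • fstMonomial 1 + sndMonomial 0).snd = monomial 0 := by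
      simp [fstMonomial, sndMonomial]
    rw [show (1 + κ) • fstMonomial 1 + sndMonomial 0 = 0 from h0] at h1
    exact monomial_zero_ne_zero h1.symm
  · rw [hu', hu]

theorem opPointSpectrum_subset_opSpectrum {E : Type*} [NormedAddCommGroup E] [NormedSpace ℂ E]
    (A : E →ₗ.[ℂ] E) : opPointSpectrum A ⊆ opSpectrum A := by
  rintro z ⟨u, hu, hu'⟩ ⟨R, hR⟩
  refine hu ?_
  rw [← hR.2 u, hu', sub_self, map_zero]

end SimilarityWave

theorem mainTheorem2 (p : ℕ) (hp : 1 < p) (hodd : Odd p) :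
    SimilarityWave.freeCore.IsClosable ∧
    (∀ z : ℂ, z ∈ SimilarityWave.opResolventSet (SimilarityWave.fullOp p) ↔
      z ∈ SimilarityWave.opResolventSet SimilarityWave.freeOp ∧
      IsUnit (ContinuousLinearMap.id ℂ SimilarityWave.H -
        SimilarityWave.pertOp p ∘L SimilarityWave.opResolvent SimilarityWave.freeOp z)) ∧
    SimilarityWave.opSpectrum (SimilarityWave.fullOp p) =
      SimilarityWave.opSpectrum SimilarityWave.freeOp ∪ {1 + 2 / ((p : ℂ) - 1)} ∧
    {z : ℂ | z ∈ SimilarityWave.opSpectrum (SimilarityWave.fullOp p) ∧ 1 / 2 < z.re} =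
      {1 + 2 / ((p : ℂ) - 1)} ∧
    1 + 2 / ((p : ℂ) - 1) ∈ SimilarityWave.opPointSpectrum (SimilarityWave.fullOp p) := by
  open SimilarityWave in
  -- Oddness serves only to exclude `p = 2`.
  have hp3 : 3 ≤ p := by
    obtain ⟨k, rfl⟩ := hodd
    omega
  have hfree : ∀ {z}, z ∈ opResolventSet (fullOp p) → z ∈ opResolventSet freeOp := fun hz =>
    mem_opResolventSet_freeOp (re_gt_of_mem_opResolventSet_fullOp hz)
  have hev := mem_opPointSpectrum_fullOp hp
  have hspec := opPointSpectrum_subset_opSpectrum _ hev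
  have hκ : 1 / 2 < (1 + 2 / ((p : ℂ) - 1)).re := by
    have hp' : (3 : ℝ) ≤ p := by exact_mod_cast hp3
    have e : (1 + 2 / ((p : ℂ) - 1)) = ((1 + 2 / ((p : ℝ) - 1) : ℝ) : ℂ) := by push_cast; rfl
    rw [e, Complex.ofReal_re]
    have : 0 ≤ 2 / ((p : ℝ) - 1) := div_nonneg zero_le_two (by linarith)
    linarith
  refine ⟨isClosable_freeCore, fun z => ?_, ?_, ?_, hev⟩
  · exact ⟨fun hz => ⟨hfree hz, (mem_opResolventSet_vadd_iff (hfree hz)).1 hz⟩,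
      fun hz => (mem_opResolventSet_vadd_iff hz.1).2 hz.2⟩
  · ext z
    refine ⟨fun hz => ?_, ?_⟩
    · by_contra h
      rw [mem_union, not_or] at h
      exact hz (mem_opResolventSet_fullOp hp3 (mem_opResolventSet_freeOp_iff.1 (not_not.1 h.1)) h.2)
    · rintro (hz | rfl)
      · exact fun h => hz (hfree h)
      · exact hspec
  · ext z
    refine ⟨fun hz => ?_, ?_⟩
    · by_contra h
      exact hz.1 (mem_opResolventSet_fullOp hp3 hz.2 h)
    · rintro rfl
      exact ⟨hspec, hκ⟩
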